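/- Let $G=(V,E\cup A)$ be a finite mixed graph with vertex set $V$, undirected edges $E$ and directed arcs $A$ (parallel edges and arcs are allowed, loops are not). A vertex $v$ is covered in a set $F\subseteq E\cup A$ if $v$ is an endpoint of some edge in $F$ or the head of some arc in $F$. A mixed covering forest in $G$ is a set $F\subseteq E\cup A$ such that (i) the underlying undirected graph of $F$ has no cycle (two parallel members of $F$ count as a cycle) and (ii) every vertex $v\in V$ is covered in $F$. Let $k$ be a non-negative integer, and suppose that $G$ contains $k$ pairwise disjoint mixed covering forests. Then $G$ contains $k$ pairwise disjoint mixed covering forests $F_1,\dots,F_k$ such that, for all $i,j\in\{1,\dots,k\}$, $$\bigl||F_i|-|F_j|\bigr|\le 1,\qquad \bigl||F_i\cap E|-|F_j\cap E|\bigr|\le 2,\qquad \bigl||F_i\cap A|-|F_j\cap A|\bigr|\le 2 .$$ -/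

import Mathlib

/-- A mixed graph `G = (V, E ∪ A)` on the vertex set `V`, with undirected edges `E` and directed
arcs `A`.  Parallel edges and arcs are allowed; loops are not. -/
structure MixedGraph (V E A : Type*) where
  /-- The unordered pair of endpoints of an edge. -/
  edgeEnds : E → Sym2 V
  /-- The tail of an arc. -/
  tail : A → V
  /-- The head of an arc. -/
  head : A → V
  edge_loopless : ∀ e, ¬ (edgeEnds e).IsDiag
  arc_loopless : ∀ a, tail a ≠ head a

namespace MixedGraph

variable {V E A : Type*} (G : MixedGraph V E A)

/-- The unordered pair of endpoints of an edge or an arc (the underlying undirected graph). -/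
def ends : E ⊕ A → Sym2 V
  | Sum.inl e => G.edgeEnds e
  | Sum.inr a => s(G.tail a, G.head a)

/-- `v` is a head of the edge or arc: both endpoints of an edge are heads, an arc has one head. -/
def IsHead (v : V) : E ⊕ A → Prop
  | Sum.inl e => v ∈ G.edgeEnds e
  | Sum.inr a => v = G.head a

/-- The vertex `v` is covered in `F`. -/
def Covered (F : Finset (E ⊕ A)) (v : V) : Prop :=
  ∃ x ∈ F, G.IsHead v x

/-- The underlying undirected multigraph of `F` contains a cycle: for some length `n + 1`, distinct
vertices `v 0, …, v n` and distinct members `x 0, …, x n` of `F`, where `x i` joins `v i` to its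
cyclic successor (addition in `Fin (n + 1)` wraps around).  Two parallel members of `F` form a cycle
of length two. -/
def HasCycle (F : Finset (E ⊕ A)) : Prop :=
  ∃ (n : ℕ) (v : Fin (n + 1) → V) (x : Fin (n + 1) → E ⊕ A),
    Function.Injective v ∧ Function.Injective x ∧
      ∀ i, x i ∈ F ∧ G.ends (x i) = s(v i, v (i + 1))

/-- A mixed covering forest: the underlying undirected graph has no cycle, and every vertex is
covered at least once. -/
def IsMixedCoveringForest (F : Finset (E ⊕ A)) : Prop :=
  ¬ G.HasCycle F ∧ ∀ v : V, G.Covered F v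

end MixedGraph

/-- The edge part `F ∩ E` of a set `F` of edges and arcs. -/
def edgePart {E A : Type*} (F : Finset (E ⊕ A)) : Finset E := F.toLeft

/-- The arc part `F ∩ A` of a set `F` of edges and arcs. -/
def arcPart {E A : Type*} (F : Finset (E ⊕ A)) : Finset A := F.toRight

/-! Call a set a mixed edge cover when every vertex is reachable along its arcs from an endpoint of
one of its edges. Mixed covering forests are covers (`IsMixedCoveringForest.isMixedEdgeCover`), and
inclusion-minimal covers are mixed covering forests (`IsMinimalCover.isMixedCoveringForest`), so one
may balance packings of covers. Take a packing that minimises lexicographically the total size, the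
sum of squared sizes, and the sum of squared edge and arc counts. By convexity it is enough that any
two members can be exchanged, inside their union and with the same total size, for a pair within the
bounds (`exists_balanced_pair`).

Edmonds' theorem on two disjoint branchings (`RootCutCondition.exists_disjoint_spansFrom`) reduces
the exchange to the edges: for a partition M₁, M₂ of the edges of the pair, the arcs can be divided
to match as soon as both classes touch every source component of the arcs. Minimality of the total
size makes the new covers minimal. Such a cover has exactly one arc per vertex not touched by its
edges, so its size is |Mᵢ| + |V| - |touched Mᵢ|, and all bounds follow from the differences of |Mᵢ|
and of |touched Mᵢ|.

These are controlled by `exists_balanced_coloring`. Edges of opposite colours are linked so that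
switching colours on whole components keeps both colours at every source component. Each component
contributes a vector (p, s) with |p|, |s - p| ≤ 1, and signs for such vectors can be chosen with
small sums (`exists_signs_balancing`). -/

/-! ### Balancing signs for planar integer vectors -/

/-- Signs can be attached to finitely many integer vectors `(p, s)` with `|p|, |s - p| ≤ 1` so that
both signed sums are at most `2` in absolute value and differ by at most `1`. -/
theorem exists_signs_balancing {κ : Type*} (S : Finset κ) (p s : κ → ℤ)
    (h : ∀ c ∈ S, |p c| ≤ 1 ∧ |s c - p c| ≤ 1) :
    ∃ ε : κ → ℤ, (∀ c, ε c = 1 ∨ ε c = -1) ∧ |∑ c ∈ S, ε c * p c| ≤ 2 ∧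
      |∑ c ∈ S, ε c * s c| ≤ 2 ∧ |∑ c ∈ S, ε c * s c - ∑ c ∈ S, ε c * p c| ≤ 1 := by
  classical
  have step : ∀ (Q : ℤ → ℤ → Prop) (P : κ → Prop),
      (∀ c x y, P c → Q x y → Q (x + p c) (y + s c) ∨ Q (x - p c) (y - s c)) →
      ∀ x y, Q x y → ∀ T : Finset κ, (∀ c ∈ T, P c) → ∃ ε : κ → ℤ, (∀ c, ε c = 1 ∨ ε c = -1) ∧
        Q (x + ∑ c ∈ T, ε c * p c) (y + ∑ c ∈ T, ε c * s c) := by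
    intro Q P hQ x y hxy T
    induction T using Finset.induction_on with
    | empty => exact fun _ => ⟨fun _ => 1, fun _ => Or.inl rfl, by simpa using hxy⟩
    | insert a T ha ih =>
      intro hT
      obtain ⟨ε, hε, hq⟩ := ih fun c hc => hT c (Finset.mem_insert_of_mem hc)
      have key : ∀ δ : ℤ, ∀ f : κ → ℤ, ∑ c ∈ insert a T, Function.update ε a δ c * f c =
          δ * f a + ∑ c ∈ T, ε c * f c := by
        intro δ f
        rw [Finset.sum_insert ha, Function.update_self]
        congr 1
        refine Finset.sum_congr rfl fun c hc => ?_
        rw [Function.update_of_ne (by rintro rfl; exact ha hc)]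
      have hup : ∀ δ : ℤ, (δ = 1 ∨ δ = -1) → ∀ c, Function.update ε a δ c = 1 ∨
          Function.update ε a δ c = -1 := by
        intro δ hδ c
        by_cases hc : c = a
        · subst hc; simpa using hδ
        · rw [Function.update_of_ne hc]; exact hε c
      rcases hQ a _ _ (hT a (Finset.mem_insert_self a T)) hq with h1 | h1
      · refine ⟨Function.update ε a 1, hup 1 (Or.inl rfl), ?_⟩
        rw [key, key]
        convert h1 using 1 <;> ring
      · refine ⟨Function.update ε a (-1), hup (-1) (Or.inr rfl), ?_⟩
        rw [key, key]
        convert h1 using 1 <;> ring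
  -- The point (2, 1) is a dead end for the vector (1, 2), and (-2, -1) likewise, so both are
  -- excluded while p ≠ 0. Vectors with p = 0 can be forced into these points, for instance from (2,
  -- 2), hence they are treated last.
  obtain ⟨ε₁, hε₁, h₁⟩ := step
    (fun x y => |x| ≤ 2 ∧ |y| ≤ 2 ∧ |y - x| ≤ 1 ∧ ¬ (x = 2 ∧ y = 1) ∧ ¬ (x = -2 ∧ y = -1))
    (fun c => (|p c| ≤ 1 ∧ |s c - p c| ≤ 1) ∧ p c ≠ 0)
    (by
      rintro c x y ⟨⟨hp, hs⟩, h0⟩ hq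
      simp only [abs_le] at *
      omega) 0 0 (by simp) (S.filter fun c => p c ≠ 0)
    (fun c hc => ⟨h c (Finset.mem_filter.1 hc).1, (Finset.mem_filter.1 hc).2⟩)
  obtain ⟨ε₂, hε₂, h₂⟩ := step
    (fun x y => |x| ≤ 2 ∧ |y| ≤ 2 ∧ |y - x| ≤ 1)
    (fun c => (|p c| ≤ 1 ∧ |s c - p c| ≤ 1) ∧ p c = 0)
    (by
      rintro c x y ⟨⟨hp, hs⟩, h0⟩ hq
      simp only [abs_le] at *
      omega) _ _ ⟨h₁.1, h₁.2.1, h₁.2.2.1⟩ (S.filter fun c => ¬ p c ≠ 0)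
    (fun c hc => ⟨h c (Finset.mem_filter.1 hc).1, not_not.1 (Finset.mem_filter.1 hc).2⟩)
  have key : ∀ f : κ → ℤ, ∑ c ∈ S, (if p c ≠ 0 then ε₁ c else ε₂ c) * f c =
      0 + ∑ c ∈ S with p c ≠ 0, ε₁ c * f c + ∑ c ∈ S with ¬ p c ≠ 0, ε₂ c * f c := by
    intro f
    rw [zero_add, ← Finset.sum_filter_add_sum_filter_not S fun c => p c ≠ 0]
    congr 1
    · exact Finset.sum_congr rfl fun c hc => by rw [if_pos (Finset.mem_filter.1 hc).2]
    · exact Finset.sum_congr rfl fun c hc => by rw [if_neg (Finset.mem_filter.1 hc).2]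
  refine ⟨fun c => if p c ≠ 0 then ε₁ c else ε₂ c, fun c => ?_, ?_⟩
  · dsimp only
    split_ifs
    exacts [hε₁ c, hε₂ c]
  · simp only [key]
    exact h₂

/-! ### Two-colourings of edges and switching along linked components -/

/-- The graph on `ι` in which `a l` and `b l` are adjacent for every `l`. -/
def linkGraph {ι Λ : Type*} (a b : Λ → ι) : SimpleGraph ι :=
  SimpleGraph.fromRel fun e f => ∃ l, a l = e ∧ b l = f

theorem linkGraph_component_eq {ι Λ : Type*} (a b : Λ → ι) (l : Λ) :
    (linkGraph a b).connectedComponentMk (a l) = (linkGraph a b).connectedComponentMk (b l) := by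
  by_cases h : a l = b l
  · rw [h]
  · refine SimpleGraph.ConnectedComponent.sound (SimpleGraph.Adj.reachable ?_)
    rw [linkGraph, SimpleGraph.fromRel_adj]
    exact ⟨h, Or.inl ⟨l, rfl, rfl⟩⟩

-- A connected graph has at most one vertex more than edges. Links that are loops or parallel only
-- enlarge the right-hand side.
open Classical in
theorem card_component_linkGraph_le {ι Λ : Type*} [Fintype ι] [Fintype Λ] (a b : Λ → ι)
    (c : (linkGraph a b).ConnectedComponent) :
    (Finset.univ.filter fun e => (linkGraph a b).connectedComponentMk e = c).card ≤
      (Finset.univ.filter fun l => (linkGraph a b).connectedComponentMk (a l) = c).card + 1 := by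
  have h := c.connected_toSimpleGraph.card_vert_le_card_edgeSet_add_one
  have hv : Nat.card c =
      (Finset.univ.filter fun e => (linkGraph a b).connectedComponentMk e = c).card := by
    rw [← Set.ncard_coe_finset, ← Nat.card_coe_set_eq]
    refine Nat.card_congr (Equiv.subtypeEquivRight fun e => ?_)
    simp
    rfl
  have he : Nat.card c.toSimpleGraph.edgeSet ≤
      (Finset.univ.filter fun l => (linkGraph a b).connectedComponentMk (a l) = c).card := by
    rw [← Fintype.card_coe, ← Nat.card_eq_fintype_card]
    let g : {x // x ∈ Finset.univ.filter fun l => (linkGraph a b).connectedComponentMk (a l) = c} →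
        Sym2 c := fun l =>
      s(⟨a l, (Finset.mem_filter.1 l.2).2⟩,
        ⟨b l, (linkGraph_component_eq a b l).symm.trans (Finset.mem_filter.1 l.2).2⟩)
    rw [Nat.card_coe_set_eq]
    refine (Set.ncard_le_ncard (t := Set.range g) ?_ (Set.toFinite _)).trans ?_
    · intro z
      induction z using Sym2.ind with
      | _ x y =>
      obtain ⟨x, hx⟩ := x
      obtain ⟨y, hy⟩ := y
      intro hxy
      rw [SimpleGraph.mem_edgeSet, SimpleGraph.ConnectedComponent.toSimpleGraph_adj, linkGraph,
        SimpleGraph.fromRel_adj] at hxy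
      obtain ⟨-, ⟨l, rfl, rfl⟩ | ⟨l, rfl, rfl⟩⟩ := hxy
      · exact ⟨⟨l, Finset.mem_filter.2 ⟨Finset.mem_univ _, hx⟩⟩, rfl⟩
      · exact ⟨⟨l, Finset.mem_filter.2 ⟨Finset.mem_univ _, hy⟩⟩, Sym2.eq_swap⟩
    · rw [← Nat.card_coe_set_eq]
      exact Nat.card_le_card_of_surjective _ Set.rangeFactorization_surjective
  omega

/-- The vertex `v` is an endpoint of an edge of colour `s`. -/
def SeesColor {V ι : Type*} (ends : ι → Sym2 V) (χ : ι → ℤ) (s : ℤ) (v : V) : Prop :=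
  ∃ e, χ e = s ∧ v ∈ ends e

/-- A colouring of the edges by `1` and `-1` such that every member of `𝒦` touches edges of both
colours. -/
def ValidColoring {V ι : Type*} (ends : ι → Sym2 V) (𝒦 : Set (Set V)) (χ : ι → ℤ) : Prop :=
  (∀ e, χ e = 1 ∨ χ e = -1) ∧
    ∀ K ∈ 𝒦, (∃ v ∈ K, SeesColor ends χ 1 v) ∧ ∃ v ∈ K, SeesColor ends χ (-1) v

/-- A set of pairs `(x, y)` of vertices, to be linked through an edge of colour `1` at `x` and an
edge of colour `-1` at `y`. -/
structure IsLinking {V ι : Type*} (ends : ι → Sym2 V) (𝒦 : Set (Set V)) (χ : ι → ℤ)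
    (L : Set (V × V)) : Prop where
  sees_fst : ∀ l ∈ L, SeesColor ends χ 1 l.1
  sees_snd : ∀ l ∈ L, SeesColor ends χ (-1) l.2
  injOn_fst : Set.InjOn Prod.fst L
  injOn_snd : Set.InjOn Prod.snd L
  diag_mem : ∀ v, SeesColor ends χ 1 v → SeesColor ends χ (-1) v → (v, v) ∈ L
  exists_mem : ∀ K ∈ 𝒦, ∃ l ∈ L, l.1 ∈ K ∧ l.2 ∈ K

/-- Take the diagonal pair at each vertex seeing both colours, and one pair for each member of `𝒦`
without such a vertex. Disjointness of `𝒦` makes both projections injective. -/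
theorem ValidColoring.exists_isLinking {V ι : Type*} {ends : ι → Sym2 V} {𝒦 : Set (Set V)}
    (h𝒦 : 𝒦.PairwiseDisjoint id) {χ : ι → ℤ} (hχ : ValidColoring ends 𝒦 χ) :
    ∃ L, IsLinking ends 𝒦 χ L := by
  set bi : V → Prop := fun v => SeesColor ends χ 1 v ∧ SeesColor ends χ (-1) v with hbi
  choose x hxK hx using fun K (hK : K ∈ 𝒦) => (hχ.2 K hK).1
  choose y hyK hy using fun K (hK : K ∈ 𝒦) => (hχ.2 K hK).2
  have huniq : ∀ K ∈ 𝒦, ∀ K' ∈ 𝒦, ∀ v, v ∈ K → v ∈ K' → K = K' := fun K hK K' hK' v hv hv' =>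
    h𝒦.elim hK hK' (Set.not_disjoint_iff.2 ⟨v, hv, hv'⟩)
  refine ⟨{l | l.1 = l.2 ∧ bi l.1} ∪ {l | ∃ K, ∃ hK : K ∈ 𝒦, (∀ v ∈ K, ¬ bi v) ∧
    l = (x K hK, y K hK)}, ?_, ?_, ?_, ?_, ?_, ?_⟩
  · rintro l (⟨-, h⟩ | ⟨K, hK, -, rfl⟩)
    exacts [h.1, hx K hK]
  · rintro l (⟨h, h'⟩ | ⟨K, hK, -, rfl⟩)
    exacts [h ▸ h'.2, hy K hK]
  · rintro ⟨a, b⟩ (⟨h, h'⟩ | ⟨K, hK, hn, h⟩) ⟨c, d⟩ (⟨g, g'⟩ | ⟨K', hK', hn', g⟩) heq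
    · simp_all
    · obtain ⟨rfl, rfl⟩ := Prod.mk.inj g
      simp only at heq h'
      exact absurd (heq ▸ h') (hn' _ (hxK _ _))
    · obtain ⟨rfl, rfl⟩ := Prod.mk.inj h
      simp only at heq g'
      exact absurd (heq ▸ g') (hn _ (hxK _ _))
    · obtain ⟨rfl, rfl⟩ := Prod.mk.inj h
      obtain ⟨rfl, rfl⟩ := Prod.mk.inj g
      obtain rfl := huniq K hK K' hK' _ (hxK K hK) (by simp only at heq; rw [heq]; exact hxK K' hK')
      rfl
  · rintro ⟨a, b⟩ (⟨h, h'⟩ | ⟨K, hK, hn, h⟩) ⟨c, d⟩ (⟨g, g'⟩ | ⟨K', hK', hn', g⟩) heq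
    · simp_all
    · obtain ⟨rfl, rfl⟩ := Prod.mk.inj g
      simp only at heq h h'
      exact absurd (heq ▸ h ▸ h') (hn' _ (hyK _ _))
    · obtain ⟨rfl, rfl⟩ := Prod.mk.inj h
      simp only at heq g g'
      exact absurd (heq ▸ g ▸ g') (hn _ (hyK _ _))
    · obtain ⟨rfl, rfl⟩ := Prod.mk.inj h
      obtain ⟨rfl, rfl⟩ := Prod.mk.inj g
      obtain rfl := huniq K hK K' hK' _ (hyK K hK) (by simp only at heq; rw [heq]; exact hyK K' hK')
      rfl
  · exact fun v h h' => Or.inl ⟨rfl, h, h'⟩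
  · intro K hK
    by_cases h : ∃ v ∈ K, bi v
    · obtain ⟨v, hv, hb⟩ := h
      exact ⟨(v, v), Or.inl ⟨rfl, hb⟩, hv, hv⟩
    · push Not at h
      exact ⟨(x K hK, y K hK), Or.inr ⟨K, hK, h, rfl⟩, hxK K hK, hyK K hK⟩

section Flip

variable {V ι : Type*} {ends : ι → Sym2 V} {𝒦 : Set (Set V)} {χ : ι → ℤ} {L : Set (V × V)}

/-- The graph on the edges obtained from a linking `L` by choosing, at the vertices concerned, edges
`r v` of colour `1` and `r' v` of colour `-1`. -/
abbrev trailGraph (L : Set (V × V)) (r r' : V → ι) : SimpleGraph ι :=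
  linkGraph (fun l : L => r l.1.1) (fun l : L => r' l.1.2)

theorem trailGraph_component_eq (r r' : V → ι) {l : V × V} (hl : l ∈ L) :
    (trailGraph L r r').connectedComponentMk (r l.1) =
      (trailGraph L r r').connectedComponentMk (r' l.2) :=
  linkGraph_component_eq (fun l : L => r l.1.1) (fun l : L => r' l.1.2) ⟨l, hl⟩

/-- Switch the colours on those components of the trail graph on which `ε` is `-1`. -/
def flipTrails (χ : ι → ℤ) (L : Set (V × V)) (r r' : V → ι)
    (ε : (trailGraph L r r').ConnectedComponent → ℤ) (e : ι) : ℤ :=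
  ε ((trailGraph L r r').connectedComponentMk e) * χ e

variable {r r' : V → ι} {ε : (trailGraph L r r').ConnectedComponent → ℤ}
  (hL : IsLinking ends 𝒦 χ L)
  (hr : ∀ v, SeesColor ends χ 1 v → χ (r v) = 1 ∧ v ∈ ends (r v))
  (hr' : ∀ v, SeesColor ends χ (-1) v → χ (r' v) = -1 ∧ v ∈ ends (r' v))
  (hε : ∀ c, ε c = 1 ∨ ε c = -1)

include hL hr hr' hε

/-- The two representative edges of a link have opposite colours and share a component, so they are
switched together or not at all. -/
theorem IsLinking.flip_sees {l : V × V} (hl : l ∈ L) :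
    (SeesColor ends (flipTrails χ L r r' ε) 1 l.1 ∧ SeesColor ends (flipTrails χ L r r' ε) (-1) l.2) ∨
      (SeesColor ends (flipTrails χ L r r' ε) (-1) l.1 ∧ SeesColor ends (flipTrails χ L r r' ε) 1 l.2) := by
  obtain ⟨h1, h2⟩ := hr _ (hL.sees_fst l hl)
  obtain ⟨h3, h4⟩ := hr' _ (hL.sees_snd l hl)
  have hc := trailGraph_component_eq r r' hl
  rcases hε ((trailGraph L r r').connectedComponentMk (r l.1)) with h | h
  · exact Or.inl ⟨⟨r l.1, by rw [flipTrails, h, h1]; rfl, h2⟩, ⟨r' l.2, by rw [flipTrails, ← hc, h, h3]; rfl, h4⟩⟩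
  · exact Or.inr ⟨⟨r l.1, by rw [flipTrails, h, h1]; rfl, h2⟩, ⟨r' l.2, by rw [flipTrails, ← hc, h, h3]; rfl, h4⟩⟩

theorem IsLinking.validColoring_flip (hχ : ∀ e, χ e = 1 ∨ χ e = -1) :
    ValidColoring ends 𝒦 (flipTrails χ L r r' ε) := by
  constructor
  · intro e
    rcases hε ((trailGraph L r r').connectedComponentMk e) with h | h <;>
      rcases hχ e with h' | h' <;> simp [flipTrails, h, h']
  · intro K hK
    obtain ⟨l, hl, h1, h2⟩ := hL.exists_mem K hK
    rcases hL.flip_sees hr hr' hε hl with h | h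
    · exact ⟨⟨_, h1, h.1⟩, ⟨_, h2, h.2⟩⟩
    · exact ⟨⟨_, h2, h.2⟩, ⟨_, h1, h.1⟩⟩

theorem IsLinking.flip_bicolored {v : V} (h1 : SeesColor ends χ 1 v)
    (h2 : SeesColor ends χ (-1) v) :
    SeesColor ends (flipTrails χ L r r' ε) 1 v ∧ SeesColor ends (flipTrails χ L r r' ε) (-1) v := by
  rcases hL.flip_sees hr hr' hε (hL.diag_mem v h1 h2) with h | h
  exacts [h, h.symm]

end Flip

/-- The edges at a vertex touching one colour only lie in one component of the trail graph. -/
def MonoConnected {V ι : Type*} (ends : ι → Sym2 V) (χ : ι → ℤ) (L : Set (V × V))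
    (r r' : V → ι) : Prop :=
  ∀ v, ¬ (SeesColor ends χ 1 v ∧ SeesColor ends χ (-1) v) → ∀ e f, v ∈ ends e → v ∈ ends f →
    (trailGraph L r r').connectedComponentMk e = (trailGraph L r r').connectedComponentMk f

-- Choose a valid colouring with the most bicoloured vertices. If a vertex seeing one colour had
-- edges in two components, switching one of them would make it bicoloured, and the diagonal links
-- keep all other bicoloured vertices so.
open Classical in
theorem exists_monoConnected {V ι : Type*} [Fintype V] [Nonempty ι] (ends : ι → Sym2 V)
    {𝒦 : Set (Set V)} (h𝒦 : 𝒦.PairwiseDisjoint id) (hex : ∃ χ, ValidColoring ends 𝒦 χ) :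
    ∃ (χ : ι → ℤ) (L : Set (V × V)) (r r' : V → ι), ValidColoring ends 𝒦 χ ∧
      IsLinking ends 𝒦 χ L ∧ (∀ v, SeesColor ends χ 1 v → χ (r v) = 1 ∧ v ∈ ends (r v)) ∧
      (∀ v, SeesColor ends χ (-1) v → χ (r' v) = -1 ∧ v ∈ ends (r' v)) ∧
      MonoConnected ends χ L r r' := by
  let N : (ι → ℤ) → Finset V := fun χ =>
    Finset.univ.filter fun v => SeesColor ends χ 1 v ∧ SeesColor ends χ (-1) v
  obtain ⟨χ, hχ, hmax⟩ : ∃ χ, ValidColoring ends 𝒦 χ ∧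
      ∀ χ', ValidColoring ends 𝒦 χ' → (N χ').card ≤ (N χ).card := by
    have hbd : ∃ n, ∀ χ, ValidColoring ends 𝒦 χ → (N χ).card ≤ n :=
      ⟨_, fun χ _ => Finset.card_le_univ _⟩
    have hfin : {n | ∃ χ, ValidColoring ends 𝒦 χ ∧ (N χ).card = n}.Finite := by
      obtain ⟨n, hn⟩ := hbd
      refine (Set.finite_Iic n).subset ?_
      rintro _ ⟨χ, h, rfl⟩
      exact hn χ h
    obtain ⟨_, ⟨χ, h, rfl⟩, hm⟩ := hfin.exists_maximal (by
      obtain ⟨χ, h⟩ := hex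
      exact ⟨_, χ, h, rfl⟩)
    refine ⟨χ, h, fun χ' h' => ?_⟩
    rcases le_total (N χ').card (N χ).card with hle | hle
    exacts [hle, hm ⟨χ', h', rfl⟩ hle]
  obtain ⟨L, hL⟩ := hχ.exists_isLinking h𝒦
  have hrep : ∀ s, ∃ r : V → ι, ∀ v, SeesColor ends χ s v → χ (r v) = s ∧ v ∈ ends (r v) := by
    intro s
    -- The arbitrary value at vertices not seeing `s` never matters.
    refine ⟨fun v => if h : SeesColor ends χ s v then h.choose else Classical.arbitrary ι,
      fun v h => ?_⟩
    simp only [dif_pos h]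
    exact h.choose_spec
  obtain ⟨r, hr⟩ := hrep 1
  obtain ⟨r', hr'⟩ := hrep (-1)
  refine ⟨χ, L, r, r', hχ, hL, hr, hr', ?_⟩
  intro v hv e f he hf
  by_contra hne
  let ε : (trailGraph L r r').ConnectedComponent → ℤ := fun c =>
    if c = (trailGraph L r r').connectedComponentMk e then -1 else 1
  have hε : ∀ c, ε c = 1 ∨ ε c = -1 := by
    intro c
    by_cases h : c = (trailGraph L r r').connectedComponentMk e <;> simp [ε, h]
  have hlt : N χ ⊂ N (flipTrails χ L r r' ε) := by
    rw [Finset.ssubset_iff_of_subset]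
    · refine ⟨v, Finset.mem_filter.2 ⟨Finset.mem_univ _, ?_⟩, fun h => hv (Finset.mem_filter.1 h).2⟩
      have h1 : flipTrails χ L r r' ε e = - χ e := by simp [flipTrails, ε]
      have h2 : flipTrails χ L r r' ε f = χ f := by simp [flipTrails, ε, Ne.symm hne]
      rcases hχ.1 e with h3 | h3 <;> rcases hχ.1 f with h4 | h4
      · exact ⟨⟨f, by rw [h2, h4], hf⟩, ⟨e, by rw [h1, h3], he⟩⟩
      · exact absurd ⟨⟨e, h3, he⟩, ⟨f, h4, hf⟩⟩ hv
      · exact absurd ⟨⟨f, h4, hf⟩, ⟨e, h3, he⟩⟩ hv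
      · exact ⟨⟨e, by rw [h1, h3]; rfl, he⟩, ⟨f, by rw [h2, h4], hf⟩⟩
    · intro w hw
      have hw := (Finset.mem_filter.1 hw).2
      exact Finset.mem_filter.2 ⟨Finset.mem_univ _, hL.flip_bicolored hr hr' hε hw.1 hw.2⟩
  exact absurd (hmax _ (hL.validColoring_flip hr hr' hε hχ.1)) (Finset.card_lt_card hlt).not_ge

-- This makes the difference of the touched counts linear in `ε`: bicoloured vertices contribute
-- zero on both sides, and at any other vertex all edges are switched together.
open Classical in
theorem MonoConnected.flip_contribution {V ι : Type*} {ends : ι → Sym2 V} {𝒦 : Set (Set V)}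
    {χ : ι → ℤ} {L : Set (V × V)} {r r' : V → ι} {ε : (trailGraph L r r').ConnectedComponent → ℤ}
    (hM : MonoConnected ends χ L r r') (hL : IsLinking ends 𝒦 χ L)
    (hr : ∀ v, SeesColor ends χ 1 v → χ (r v) = 1 ∧ v ∈ ends (r v))
    (hr' : ∀ v, SeesColor ends χ (-1) v → χ (r' v) = -1 ∧ v ∈ ends (r' v))
    (hε : ∀ c, ε c = 1 ∨ ε c = -1) (hχ : ∀ e, χ e = 1 ∨ χ e = -1) (v : V) :
    (if SeesColor ends (flipTrails χ L r r' ε) 1 v then (1 : ℤ) else 0) -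
        (if SeesColor ends (flipTrails χ L r r' ε) (-1) v then 1 else 0) =
      (if SeesColor ends χ 1 v then ε ((trailGraph L r r').connectedComponentMk (r v)) else 0) -
        (if SeesColor ends χ (-1) v then
          ε ((trailGraph L r r').connectedComponentMk (r' v)) else 0) := by
  have hmono : ∀ s c, (∀ e, v ∈ ends e → χ e = s ∧
      (trailGraph L r r').connectedComponentMk e = c) → SeesColor ends χ s v →
      ∀ t, SeesColor ends (flipTrails χ L r r' ε) t v ↔ ε c * s = t := by
    intro s c h hs t
    constructor
    · rintro ⟨e, rfl, he⟩
      rw [flipTrails, (h e he).1, (h e he).2]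
    · rintro rfl
      obtain ⟨e, -, he⟩ := hs
      exact ⟨e, by rw [flipTrails, (h e he).1, (h e he).2], he⟩
  by_cases h1 : SeesColor ends χ 1 v <;> by_cases h2 : SeesColor ends χ (-1) v
  · obtain ⟨h3, h4⟩ := hL.flip_bicolored hr hr' hε h1 h2
    rw [if_pos h1, if_pos h2, if_pos h3, if_pos h4,
      trailGraph_component_eq r r' (hL.diag_mem v h1 h2)]
    ring
  · have h := hmono 1 _ (fun e he => ⟨(hχ e).resolve_right fun h => h2 ⟨e, h, he⟩,
      hM v (fun h => h2 h.2) e (r v) he (hr v h1).2⟩) h1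
    rw [if_pos h1, if_neg h2]
    simp only [h]
    rcases hε ((trailGraph L r r').connectedComponentMk (r v)) with h' | h' <;> simp [h']
  · have h := hmono (-1) _ (fun e he => ⟨(hχ e).resolve_left fun h => h1 ⟨e, h, he⟩,
      hM v (fun h => h1 h.1) e (r' v) he (hr' v h2).2⟩) h2
    rw [if_neg h1, if_pos h2]
    simp only [h]
    rcases hε ((trailGraph L r r').connectedComponentMk (r' v)) with h' | h' <;> simp [h']
  · have h : ∀ t, ¬ SeesColor ends (flipTrails χ L r r' ε) t v := by
      rintro t ⟨e, -, he⟩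
      rcases hχ e with h' | h'
      exacts [h1 ⟨e, h', he⟩, h2 ⟨e, h', he⟩]
    simp [h, h1, h2]

theorem card_representatives_le {V ι : Type*} [Fintype V] (ends : ι → Sym2 V) (r : V → ι)
    (P : V → Prop) [DecidablePred P] (h : ∀ v, P v → v ∈ ends (r v)) (T : Finset ι) (hT : ∀ v, P v → r v ∈ T) :
    (Finset.univ.filter P).card ≤ 2 * T.card := by
  classical
  refine Finset.card_le_mul_card_image_of_maps_to (f := r)
    (fun v hv => hT v (Finset.mem_filter.1 hv).2) 2 fun e _ => ?_
  calc _ ≤ (ends e).toFinset.card := by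
        refine Finset.card_le_card fun v hv => ?_
        obtain ⟨hP, rfl⟩ := Finset.mem_filter.1 hv
        exact Sym2.mem_toFinset.2 (h v (Finset.mem_filter.1 hP).2)
    _ ≤ 2 := by
        rw [Sym2.card_toFinset]
        split_ifs <;> omega

open Classical in
/-- If the edges of a finite graph can be coloured by two colours so that each of the pairwise
disjoint vertex sets in `𝒦` touches both colours, then there is such a colouring for which the
colour classes, the sets of vertices they touch, and the differences of these two sizes are
balanced. -/
theorem exists_balanced_coloring {V ι : Type*} [Fintype V] [Fintype ι] (ends : ι → Sym2 V)
    {𝒦 : Set (Set V)} (h𝒦 : 𝒦.PairwiseDisjoint id) (hex : ∃ χ, ValidColoring ends 𝒦 χ) :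
    ∃ χ, ValidColoring ends 𝒦 χ ∧ |∑ e, χ e| ≤ 2 ∧
      |∑ v, ((if SeesColor ends χ 1 v then (1 : ℤ) else 0) -
        (if SeesColor ends χ (-1) v then 1 else 0))| ≤ 2 ∧
      |∑ v, ((if SeesColor ends χ 1 v then (1 : ℤ) else 0) -
        (if SeesColor ends χ (-1) v then 1 else 0)) - ∑ e, χ e| ≤ 1 := by
  rcases isEmpty_or_nonempty ι with hι | hι
  · obtain ⟨χ, hχ⟩ := hex
    exact ⟨χ, hχ, by simp [SeesColor]⟩
  obtain ⟨χ, L, r, r', hχ, hL, hr, hr', hM⟩ := exists_monoConnected ends h𝒦 hex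
  have : Fintype L := Fintype.ofFinite L
  let mk := (trailGraph L r r').connectedComponentMk
  let p : (trailGraph L r r').ConnectedComponent → ℤ := fun c =>
    ∑ e, if mk e = c then χ e else 0
  let s : (trailGraph L r r').ConnectedComponent → ℤ := fun c =>
    ∑ v, ((if SeesColor ends χ 1 v ∧ mk (r v) = c then (1 : ℤ) else 0) -
      (if SeesColor ends χ (-1) v ∧ mk (r' v) = c then 1 else 0))
  -- In the component, let n₊, n₋ count the edges of each colour, m the links, and s₊, s₋ the
  -- vertices represented by these edges. Then n₊ + n₋ ≤ m + 1, m ≤ s₊ ≤ 2n₊ and m ≤ s₋ ≤ 2n₋, which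
  -- yield both bounds.
  have hgood : ∀ c, |p c| ≤ 1 ∧ |s c - p c| ≤ 1 := by
    intro c
    have hconn : (Finset.univ.filter fun e => mk e = c).card ≤
        (Finset.univ.filter fun l : L => mk (r l.1.1) = c).card + 1 :=
      card_component_linkGraph_le (fun l : L => r l.1.1) (fun l : L => r' l.1.2) c
    have hsplit : (Finset.univ.filter fun e => mk e = c).card =
        (Finset.univ.filter fun e => mk e = c ∧ χ e = 1).card +
        (Finset.univ.filter fun e => mk e = c ∧ χ e = -1).card := by
      rw [← Finset.card_filter_add_card_filter_not fun e => χ e = 1, Finset.filter_filter,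
        Finset.filter_filter]
      congr 2
      ext e
      rcases hχ.1 e with h | h <;> simp [h]
    have hp : p c = (Finset.univ.filter fun e => mk e = c ∧ χ e = 1).card -
        (Finset.univ.filter fun e => mk e = c ∧ χ e = -1).card := by
      rw [Finset.card_filter, Finset.card_filter]
      push_cast
      rw [← Finset.sum_sub_distrib]
      refine Finset.sum_congr rfl fun e _ => ?_
      by_cases hc : mk e = c <;> rcases hχ.1 e with h | h <;> simp [h, hc]
    have hs : s c = (Finset.univ.filter fun v => SeesColor ends χ 1 v ∧ mk (r v) = c).card -
        (Finset.univ.filter fun v => SeesColor ends χ (-1) v ∧ mk (r' v) = c).card := by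
      rw [Finset.card_filter, Finset.card_filter]
      push_cast
      rw [← Finset.sum_sub_distrib]
    have h1 : (Finset.univ.filter fun l : L => mk (r l.1.1) = c).card ≤
        (Finset.univ.filter fun v => SeesColor ends χ 1 v ∧ mk (r v) = c).card :=
      Finset.card_le_card_of_injOn (fun l : L => l.1.1)
        (fun l hl => by
          simp only [Finset.coe_filter, Finset.mem_univ, true_and, Set.mem_ofPred_eq] at hl ⊢
          exact ⟨hL.sees_fst _ l.2, hl⟩)
        (fun l _ l' _ h => Subtype.ext (hL.injOn_fst l.2 l'.2 h))
    have h2 : (Finset.univ.filter fun l : L => mk (r l.1.1) = c).card ≤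
        (Finset.univ.filter fun v => SeesColor ends χ (-1) v ∧ mk (r' v) = c).card :=
      Finset.card_le_card_of_injOn (fun l : L => l.1.2)
        (fun l hl => by
          simp only [Finset.coe_filter, Finset.mem_univ, true_and, Set.mem_ofPred_eq] at hl ⊢
          exact ⟨hL.sees_snd _ l.2, (trailGraph_component_eq r r' l.2).symm.trans hl⟩)
        (fun l _ l' _ h => Subtype.ext (hL.injOn_snd l.2 l'.2 h))
    have h3 := card_representatives_le ends r
      (fun v => SeesColor ends χ 1 v ∧ mk (r v) = c) (fun v h => (hr v h.1).2)
      (Finset.univ.filter fun e => mk e = c ∧ χ e = 1)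
      (fun v h => Finset.mem_filter.2 ⟨Finset.mem_univ _, h.2, (hr v h.1).1⟩)
    have h4 := card_representatives_le ends r'
      (fun v => SeesColor ends χ (-1) v ∧ mk (r' v) = c) (fun v h => (hr' v h.1).2)
      (Finset.univ.filter fun e => mk e = c ∧ χ e = -1)
      (fun v h => Finset.mem_filter.2 ⟨Finset.mem_univ _, h.2, (hr' v h.1).1⟩)
    rw [hp, hs]
    simp only [abs_le]
    omega
  obtain ⟨ε, hε, hb⟩ := exists_signs_balancing Finset.univ p s fun c _ => hgood c
  have hsum : ∑ c, ε c * p c = ∑ e, flipTrails χ L r r' ε e := by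
    simp only [p, Finset.mul_sum, mul_ite, mul_zero]
    rw [Finset.sum_comm]
    exact Finset.sum_congr rfl fun e _ => by simp [flipTrails, mk]
  have hsee : ∑ c, ε c * s c =
      ∑ v, ((if SeesColor ends (flipTrails χ L r r' ε) 1 v then (1 : ℤ) else 0) -
        (if SeesColor ends (flipTrails χ L r r' ε) (-1) v then 1 else 0)) := by
    simp only [s, Finset.mul_sum]
    rw [Finset.sum_comm]
    refine Finset.sum_congr rfl fun v _ => ?_
    rw [hM.flip_contribution hL hr hr' hε hχ.1 v]
    simp only [mul_sub, Finset.sum_sub_distrib, mul_ite, mul_one, mul_zero, ite_and]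
    congr 1
    · by_cases h : SeesColor ends χ 1 v <;> simp [h, mk]
    · by_cases h : SeesColor ends χ (-1) v <;> simp [h, mk]
  rw [hsum, hsee] at hb
  exact ⟨_, hL.validColoring_flip hr hr' hε hχ.1, hb⟩

/-! ### Edmonds' disjoint branchings for two root sets -/

open Classical in
/-- The arcs in `B` that enter the vertex set `X`. -/
noncomputable def enteringArcs {V A : Type*} (tail head : A → V) (B : Finset A) (X : Set V) :
    Finset A :=
  B.filter fun a => tail a ∉ X ∧ head a ∈ X

theorem mem_enteringArcs {V A : Type*} {tail head : A → V} {B : Finset A} {X : Set V} {a : A} :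
    a ∈ enteringArcs tail head B X ↔ a ∈ B ∧ tail a ∉ X ∧ head a ∈ X := by
  simp [enteringArcs]

/-- Submodularity of the in-degree, valid for each arc separately. -/
theorem card_enteringArcs_inter_add_union_le {V A : Type*} (tail head : A → V) (B : Finset A)
    (X Z : Set V) :
    (enteringArcs tail head B (X ∩ Z)).card + (enteringArcs tail head B (X ∪ Z)).card ≤
      (enteringArcs tail head B X).card + (enteringArcs tail head B Z).card := by
  classical
  simp only [enteringArcs, Finset.card_filter, ← Finset.sum_add_distrib]
  refine Finset.sum_le_sum fun a _ => ?_
  by_cases h1 : tail a ∈ X <;> by_cases h2 : tail a ∈ Z <;> by_cases h3 : head a ∈ X <;>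
    by_cases h4 : head a ∈ Z <;> simp [h1, h2, h3, h4]

open Classical in
/-- The number of the root sets `R₁`, `R₂` that `X` misses. -/
noncomputable def rootDemand {V : Type*} (R₁ R₂ X : Set V) : ℕ :=
  (if Disjoint X R₁ then 1 else 0) + (if Disjoint X R₂ then 1 else 0)

/-- The cut condition for packing two branchings with root sets `R₁` and `R₂`. -/
def RootCutCondition {V A : Type*} (tail head : A → V) (B : Finset A) (R₁ R₂ : Set V) : Prop :=
  ∀ X : Set V, X.Nonempty → rootDemand R₁ R₂ X ≤ (enteringArcs tail head B X).card

/-- Every nonempty vertex set that misses `R` is entered by `B`, that is, every vertex can be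
reached from `R` along arcs of `B`. -/
def SpansFrom {V A : Type*} (tail head : A → V) (B : Finset A) (R : Set V) : Prop :=
  ∀ X : Set V, X.Nonempty → Disjoint X R → (enteringArcs tail head B X).Nonempty

section Packing

variable {V A : Type*} {tail head : A → V} {B : Finset A} {R₁ R₂ : Set V}

-- A newly violated set must lose the arc `a`, so it contains the head and owes nothing to the
-- enlarged first root set. Its remaining demand comes from `R₂` alone, and it has no other entering
-- arc. By the old condition it then meets `R₁`.
open Classical in
theorem RootCutCondition.exists_tight (h : RootCutCondition tail head B R₁ R₂) {a : A}
    (ha : a ∈ B) (hbad : ¬ RootCutCondition tail head (B.erase a) (insert (head a) R₁) R₂) :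
    ∃ X : Set V, tail a ∉ X ∧ head a ∈ X ∧ Disjoint X R₂ ∧ ¬ Disjoint X R₁ ∧
      (enteringArcs tail head B X).card = 1 := by
  unfold RootCutCondition at hbad
  push Not at hbad
  obtain ⟨X, hX, hlt⟩ := hbad
  have hX' := h X hX
  by_cases hin : a ∈ enteringArcs tail head B X
  · have herase : enteringArcs tail head (B.erase a) X = (enteringArcs tail head B X).erase a := by
      ext b
      simp only [mem_enteringArcs, Finset.mem_erase]
      tauto
    obtain ⟨-, ht, hh⟩ := mem_enteringArcs.1 hin
    have hnd : ¬ Disjoint X (insert (head a) R₁) :=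
      Set.not_disjoint_iff.2 ⟨_, hh, Set.mem_insert _ _⟩
    have hpos := Finset.card_pos.2 ⟨a, hin⟩
    rw [herase, Finset.card_erase_of_mem hin, rootDemand, if_neg hnd] at hlt
    rw [rootDemand] at hX'
    refine ⟨X, ht, hh, ?_⟩
    split_ifs at hlt hX' <;> first | omega | (refine ⟨‹_›, ‹_›, ?_⟩; omega)
  · have herase : enteringArcs tail head (B.erase a) X = enteringArcs tail head B X := by
      ext b
      simp only [mem_enteringArcs, Finset.mem_erase] at hin ⊢
      constructor
      · tauto
      · intro hb
        exact ⟨⟨by rintro rfl; exact hin hb, hb.1⟩, hb.2⟩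
    have hle : rootDemand (insert (head a) R₁) R₂ X ≤ rootDemand R₁ R₂ X := by
      unfold rootDemand
      gcongr
      by_cases hd : Disjoint X (insert (head a) R₁)
      · rw [if_pos hd, if_pos (hd.mono_right (Set.subset_insert _ _))]
      · rw [if_neg hd]
        exact Nat.zero_le _
    rw [herase] at hlt
    omega

theorem RootCutCondition.one_le (h : RootCutCondition tail head B R₁ R₂) {X : Set V}
    (hX : X.Nonempty) (hd : Disjoint X R₂) : 1 ≤ (enteringArcs tail head B X).card := by
  have := h X hX
  rw [rootDemand, if_pos hd] at this
  omega

theorem RootCutCondition.two_le (h : RootCutCondition tail head B R₁ R₂) {X : Set V}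
    (hX : X.Nonempty) (h₁ : Disjoint X R₁) (h₂ : Disjoint X R₂) :
    2 ≤ (enteringArcs tail head B X).card := by
  have := h X hX
  rwa [rootDemand, if_pos h₁, if_pos h₂] at this

-- Lovász's argument. If no tight set obstructs, any arc leaving `R₁` will do. Otherwise take a
-- minimal obstructing `X`: at least two arcs enter `X \ R₁` but only one enters `X`, so some arc
-- runs from `X ∩ R₁` to `X \ R₁`. If it failed, a tight `Z` would witness this, and submodularity
-- would make `X ∩ Z` a smaller obstruction.
open Classical in
theorem RootCutCondition.exists_arc [Finite V] (h : RootCutCondition tail head B R₁ R₂)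
    (hR : R₁ ≠ Set.univ) :
    ∃ a ∈ B, tail a ∈ R₁ ∧ head a ∉ R₁ ∧
      RootCutCondition tail head (B.erase a) (insert (head a) R₁) R₂ := by
  let 𝒯 : Set (Set V) := {X | Disjoint X R₂ ∧ ¬ Disjoint X R₁ ∧
    (enteringArcs tail head B X).card = 1 ∧ ¬ X ⊆ R₁}
  rcases 𝒯.eq_empty_or_nonempty with hT | hT
  · have hne : (R₁ᶜ).Nonempty := Set.nonempty_compl.2 hR
    have hcard : 1 ≤ (enteringArcs tail head B R₁ᶜ).card := by
      have := h _ hne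
      rw [rootDemand, if_pos disjoint_compl_left] at this
      omega
    obtain ⟨a, ha⟩ := Finset.card_pos.1 hcard
    obtain ⟨haB, ht, hh⟩ := mem_enteringArcs.1 ha
    refine ⟨a, haB, not_not.1 ht, hh, ?_⟩
    by_contra hbad
    obtain ⟨X, -, hX, h1, h2, h3⟩ := h.exists_tight haB hbad
    have : X ∈ 𝒯 := ⟨h1, h2, h3, fun hs => hh (hs hX)⟩
    rw [hT] at this
    exact this
  · obtain ⟨X, hX⟩ := 𝒯.toFinite.exists_minimal hT
    obtain ⟨hX₂, hX₁, hX1, hXR⟩ := hX.prop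
    have h2 : 2 ≤ (enteringArcs tail head B (X \ R₁)).card :=
      h.two_le (Set.sdiff_nonempty.2 hXR) Set.disjoint_sdiff_left (hX₂.mono_left Set.sdiff_subset)
    obtain ⟨a, ha, ha'⟩ : ∃ a ∈ enteringArcs tail head B (X \ R₁),
        a ∉ enteringArcs tail head B X := by
      by_contra! hsub
      have := Finset.card_le_card hsub
      omega
    obtain ⟨haB, ht, hh⟩ := mem_enteringArcs.1 ha
    have htX : tail a ∈ X := by
      by_contra hn
      exact ha' (mem_enteringArcs.2 ⟨haB, hn, hh.1⟩)
    refine ⟨a, haB, by_contra fun hn => ht ⟨htX, hn⟩, hh.2, ?_⟩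
    by_contra hbad
    obtain ⟨Z, hZt, hZh, hZ₂, hZ₁, hZ1⟩ := h.exists_tight haB hbad
    have hsub := card_enteringArcs_inter_add_union_le tail head B X Z
    have hne : (X ∩ Z).Nonempty := ⟨_, hh.1, hZh⟩
    have hu := h.one_le (X := X ∪ Z) ⟨_, Or.inl htX⟩ (Set.disjoint_union_left.2 ⟨hX₂, hZ₂⟩)
    have hi := h.one_le hne (hX₂.mono_left Set.inter_subset_left)
    have hmem : X ∩ Z ∈ 𝒯 := by
      refine ⟨hX₂.mono_left Set.inter_subset_left, fun hd => ?_, by omega,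
        fun hs => hh.2 (hs ⟨hh.1, hZh⟩)⟩
      have := h.two_le hne hd (hX₂.mono_left Set.inter_subset_left)
      omega
    exact hZt ((hX.le_of_le hmem Set.inter_subset_left htX).2)

open Classical in
/-- Edmonds' disjoint branchings theorem for two branchings with prescribed root sets. -/
theorem RootCutCondition.exists_disjoint_spansFrom [Finite V]
    (h : RootCutCondition tail head B R₁ R₂) :
    ∃ B₁ B₂ : Finset A, B₁ ⊆ B ∧ B₂ ⊆ B ∧ Disjoint B₁ B₂ ∧
      SpansFrom tail head B₁ R₁ ∧ SpansFrom tail head B₂ R₂ := by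
  induction hn : (R₁ᶜ).ncard using Nat.strong_induction_on generalizing B R₁ with
  | _ n ih =>
  by_cases hR : R₁ = Set.univ
  · subst hR
    refine ⟨∅, B, Finset.empty_subset _, subset_rfl, Finset.disjoint_empty_left _, ?_, ?_⟩
    · intro X hX hd
      exact absurd (Set.disjoint_univ.1 hd) hX.ne_empty
    · intro X hX hd
      exact Finset.card_pos.1 (h.one_le hX hd)
  · obtain ⟨a, haB, ht, hh, hcut⟩ := h.exists_arc hR
    have hlt : ((insert (head a) R₁)ᶜ).ncard < n := by
      rw [← hn]
      exact Set.ncard_lt_ncard (compl_lt_compl_iff_lt.2 (Set.ssubset_insert hh)) (Set.toFinite _)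
    obtain ⟨B₁, B₂, hB₁, hB₂, hd, hs₁, hs₂⟩ := ih _ hlt hcut rfl
    refine ⟨insert a B₁, B₂, ?_, hB₂.trans (Finset.erase_subset _ _), ?_, ?_, hs₂⟩
    · exact Finset.insert_subset haB (hB₁.trans (Finset.erase_subset _ _))
    · exact Finset.disjoint_insert_left.2 ⟨fun hm => Finset.notMem_erase a B (hB₂ hm), hd⟩
    · intro X hX hdX
      by_cases hm : head a ∈ X
      · exact ⟨a, mem_enteringArcs.2 ⟨Finset.mem_insert_self _ _,
          fun htX => Set.disjoint_left.1 hdX htX ht, hm⟩⟩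
      · obtain ⟨b, hb⟩ := hs₁ X hX (by
          rw [Set.disjoint_left] at hdX ⊢
          rintro x hx (rfl | hxR)
          exacts [hm hx, hdX hx hxR])
        obtain ⟨hb, hb'⟩ := mem_enteringArcs.1 hb
        exact ⟨b, mem_enteringArcs.2 ⟨Finset.mem_insert_of_mem hb, hb'⟩⟩

end Packing

/-! ### Spanning arc sets and rank functions -/

section Spanning

variable {V A : Type*} {tail head : A → V} {B B' : Finset A} {R : Set V}

theorem SpansFrom.mono (h : SpansFrom tail head B R) (hB : B ⊆ B') :
    SpansFrom tail head B' R := fun X hX hd => by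
  obtain ⟨a, ha⟩ := h X hX hd
  obtain ⟨ha, ha'⟩ := mem_enteringArcs.1 ha
  exact ⟨a, mem_enteringArcs.2 ⟨hB ha, ha'⟩⟩

theorem SpansFrom.exists_rank (h : SpansFrom tail head B R) :
    ∃ rank : V → ℕ, ∀ v ∉ R, ∃ a ∈ B, head a = v ∧ rank (tail a) < rank v := by
  classical
  -- `S n` consists of the vertices within `n` arcs of `R`. A vertex in no layer would give a set
  -- missing `R` that no arc enters.
  let S : ℕ → Set V := fun n => Nat.rec (motive := fun _ => Set V) R (fun _ S => S ∪ {v | ∃ a ∈ B, head a = v ∧ tail a ∈ S}) n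
  have hS : ∀ v, ∃ n, v ∈ S n := by
    by_contra! hne
    obtain ⟨a, ha⟩ := h {v | ∀ n, v ∉ S n} hne
      (Set.disjoint_left.2 fun v hv hR => hv 0 hR)
    obtain ⟨haB, ht, hh⟩ := mem_enteringArcs.1 ha
    simp only [Set.mem_ofPred_eq, not_forall, not_not] at ht
    obtain ⟨n, hn⟩ := ht
    exact hh (n + 1) (Or.inr ⟨a, haB, rfl, hn⟩)
  refine ⟨fun v => Nat.find (hS v), fun v hv => ?_⟩
  obtain ⟨m, hm⟩ : ∃ m, Nat.find (hS v) = m + 1 := by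
    refine Nat.exists_eq_succ_of_ne_zero fun h0 => hv ?_
    have := Nat.find_spec (hS v)
    rwa [h0] at this
  have hspec := Nat.find_spec (hS v)
  rw [hm] at hspec
  rcases hspec with h1 | ⟨a, haB, hav, ht⟩
  · exact absurd h1 (Nat.find_min (hS v) (by omega))
  · refine ⟨a, haB, hav, ?_⟩
    have := Nat.find_min' (hS (tail a)) ht
    simp only [hm]
    omega

/-- At a vertex of least rank in `X`, the given arc has its tail outside `X`. -/
theorem spansFrom_of_rank {rank : V → ℕ}
    (h : ∀ v ∉ R, ∃ a ∈ B, head a = v ∧ rank (tail a) < rank v) : SpansFrom tail head B R := by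
  classical
  intro X hX hd
  obtain ⟨v, hv, hmin⟩ : ∃ v ∈ X, ∀ w ∈ X, rank v ≤ rank w := by
    obtain ⟨v, hv, hmin⟩ := WellFounded.has_min (measure rank).wf X hX
    exact ⟨v, hv, fun w hw => not_lt.1 (hmin w hw)⟩
  obtain ⟨a, haB, rfl, hlt⟩ := h v (Set.disjoint_left.1 hd hv)
  exact ⟨a, mem_enteringArcs.2 ⟨haB, fun ht => (hmin _ ht).not_gt hlt, hv⟩⟩

open Classical in
/-- An inclusion-minimal set of arcs spanning from `R` consists of one arc for each vertex outside
`R`, and contains no directed cycle. -/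
theorem SpansFrom.structure_of_minimal [Finite V] (h : SpansFrom tail head B R)
    (hmin : ∀ a ∈ B, ¬ SpansFrom tail head (B.erase a) R) :
    ∃ rank : V → ℕ, (∀ a ∈ B, head a ∉ R ∧ rank (tail a) < rank (head a)) ∧
      Set.InjOn head B ∧ ∀ v ∉ R, ∃ a ∈ B, head a = v := by
  obtain ⟨rank, hrank⟩ := h.exists_rank
  choose par hparB hparh hparr using hrank
  -- An arc that is not the chosen parent arc of its head could be erased, since the parent arcs
  -- with the same rank still certify spanning.
  have hpar : ∀ a ∈ B, ∃ hv : head a ∉ R, par (head a) hv = a := by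
    intro a ha
    by_contra hcon
    refine hmin a ha (spansFrom_of_rank (rank := rank) fun v hv =>
      ⟨par v hv, Finset.mem_erase.2 ⟨?_, hparB v hv⟩, hparh v hv, hparr v hv⟩)
    rintro rfl
    exact hcon ⟨by rwa [hparh v hv], by simp only [hparh v hv]⟩
  refine ⟨rank, fun a ha => ?_, fun a ha b hb hab => ?_,
    fun v hv => ⟨par v hv, hparB v hv, hparh v hv⟩⟩
  · obtain ⟨hv, hpa⟩ := hpar a ha
    have := hparr _ hv
    rw [hpa] at this
    exact ⟨hv, this⟩
  · obtain ⟨hv, hpa⟩ := hpar a ha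
    obtain ⟨hw, hpb⟩ := hpar b hb
    rw [← hpa, ← hpb]
    simp only [hab]

end Spanning

/-! ### Mixed edge covers and covering forests -/

namespace MixedGraph

variable {V E A : Type*} (G : MixedGraph V E A)

/-- The vertices touched by the undirected edges in `M`. -/
def touched (M : Finset E) : Set V := {v | ∃ e ∈ M, v ∈ G.edgeEnds e}

/-- A mixed edge cover: every vertex is reachable along arcs of `F` from an endpoint of an edge
of `F`. -/
def IsMixedEdgeCover (F : Finset (E ⊕ A)) : Prop :=
  SpansFrom G.tail G.head (arcPart F) (G.touched (edgePart F))

variable {G} {F : Finset (E ⊕ A)}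

/-- In an unentered set missing all touched vertices, each vertex is covered by an arc whose tail is
again in the set. Following tails in a finite set closes a cycle. -/
theorem IsMixedCoveringForest.isMixedEdgeCover [Finite V] (h : G.IsMixedCoveringForest F) :
    G.IsMixedEdgeCover F := by
  intro X hX hd
  by_contra hemp
  rw [Finset.not_nonempty_iff_eq_empty] at hemp
  have harc : ∀ v : X, ∃ a, Sum.inr a ∈ F ∧ G.head a = v ∧ G.tail a ∈ X := by
    rintro ⟨v, hv⟩
    obtain ⟨e | a, hF, hx⟩ := h.2 v
    · exact absurd ⟨e, Finset.mem_toLeft.2 hF, hx⟩ (Set.disjoint_left.1 hd hv)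
    · refine ⟨a, hF, hx.symm, ?_⟩
      by_contra ht
      have : a ∈ enteringArcs G.tail G.head (arcPart F) X :=
        mem_enteringArcs.2 ⟨Finset.mem_toRight.2 hF, ht, by rw [← hx]; exact hv⟩
      rw [hemp] at this
      exact absurd this (Finset.notMem_empty a)
  choose f hfF hfh hft using harc
  let g : X → X := fun v => ⟨G.tail (f v), hft v⟩
  obtain ⟨x⟩ := hX.to_subtype
  obtain ⟨y, m, hm, hy⟩ : ∃ y, ∃ m, 0 < m ∧ Function.IsPeriodicPt g m y := by
    obtain ⟨i, j, hne, hij⟩ := Finite.exists_ne_map_eq_of_infinite fun n => g^[n] x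
    wlog hlt : i < j generalizing i j
    · exact this j i hne.symm hij.symm (lt_of_le_of_ne (not_lt.1 hlt) hne.symm)
    refine ⟨g^[i] x, j - i, Nat.sub_pos_of_lt hlt, ?_⟩
    rw [Function.IsPeriodicPt, Function.IsFixedPt, ← Function.iterate_add_apply,
      Nat.sub_add_cancel hlt.le]
    exact hij.symm
  -- The least period makes the vertices on the cycle distinct, and matches the wrap-around in `Fin
  -- (n + 1)`.
  obtain ⟨n, hn⟩ : ∃ n, Function.minimalPeriod g y = n + 1 :=
    Nat.exists_eq_succ_of_ne_zero (hy.minimalPeriod_pos hm).ne'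
  have hinj : Function.Injective fun i : Fin (n + 1) => g^[i] y := fun i j hij =>
    Fin.ext (Function.iterate_injOn_Iio_minimalPeriod (by simp [hn]; omega) (by simp [hn]; omega) hij)
  refine h.1 ⟨n, fun i => (g^[i] y : X), fun i => Sum.inr (f (g^[i] y)),
    Subtype.val_injective.comp hinj, fun i j hij => ?_, fun i => ⟨hfF _, ?_⟩⟩
  · have := congrArg G.head (Sum.inr_injective hij)
    rw [hfh, hfh] at this
    exact hinj (Subtype.ext this)
  · have hsucc : g^[(i + 1 : Fin (n + 1))] y = g (g^[i] y) := by
      rw [← Function.iterate_succ_apply' g, ← Function.iterate_mod_minimalPeriod_eq (n := i + 1), hn,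
        Fin.val_add, Fin.val_one', Nat.add_mod_mod]
    change s(G.tail (f (g^[i] y)), G.head (f (g^[i] y))) =
      s(((g^[i] y : X) : V), ((g^[(i + 1 : Fin (n + 1))] y : X) : V))
    rw [hsucc, hfh, Sym2.eq_swap]

variable (G) in
/-- A mixed edge cover from which no member can be removed. -/
def IsMinimalCover [DecidableEq E] [DecidableEq A] (F : Finset (E ⊕ A)) : Prop :=
  G.IsMixedEdgeCover F ∧ ∀ x ∈ F, ¬ G.IsMixedEdgeCover (F.erase x)

section Minimal

variable [DecidableEq E] [DecidableEq A]

theorem IsMinimalCover.exists_rank [Finite V] (h : G.IsMinimalCover F) :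
    ∃ rank : V → ℕ, (∀ a ∈ arcPart F, G.head a ∉ G.touched (edgePart F) ∧
        rank (G.tail a) < rank (G.head a)) ∧
      Set.InjOn G.head (arcPart F) ∧ ∀ v ∉ G.touched (edgePart F), ∃ a ∈ arcPart F, G.head a = v := by
  refine SpansFrom.structure_of_minimal h.1 fun a ha hs =>
    h.2 (Sum.inr a) (Finset.mem_toRight.1 ha) ?_
  have h1 : edgePart (F.erase (Sum.inr a)) = edgePart F := by ext; simp [edgePart]
  rw [IsMixedEdgeCover, h1]
  refine hs.mono fun b hb => ?_
  simp only [arcPart, Finset.mem_erase, Finset.mem_toRight] at hb ⊢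
  exact ⟨fun h => hb.1 (Sum.inr_injective h), hb.2⟩

/-- The head map is a bijection from the arcs onto the untouched vertices. Arc counts thereby become
functions of the edge part. -/
theorem IsMinimalCover.card_arcPart [Finite V] (h : G.IsMinimalCover F) :
    (arcPart F).card = (G.touched (edgePart F))ᶜ.ncard := by
  obtain ⟨rank, h1, h2, h3⟩ := h.exists_rank
  rw [← Set.ncard_coe_finset, ← h2.ncard_image]
  congr 1
  ext v
  constructor
  · rintro ⟨a, ha, rfl⟩
    exact (h1 a ha).1
  · intro hv
    obtain ⟨a, ha, rfl⟩ := h3 v hv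
    exact ⟨a, ha, rfl⟩

/-- Otherwise erasing `e` would leave the touched set, hence the cover property, unchanged. -/
theorem IsMinimalCover.exists_private_end (h : G.IsMinimalCover F) {e : E} (he : Sum.inl e ∈ F) :
    ∃ v ∈ G.edgeEnds e, ∀ f, Sum.inl f ∈ F → v ∈ G.edgeEnds f → f = e := by
  by_contra! hcon
  refine h.2 _ he ?_
  have h1 : arcPart (F.erase (Sum.inl e)) = arcPart F := by ext; simp [arcPart]
  have h2 : G.touched (edgePart (F.erase (Sum.inl e))) = G.touched (edgePart F) := by
    ext v
    constructor
    · rintro ⟨f, hf, hv⟩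
      exact ⟨f, Finset.mem_toLeft.2 (Finset.mem_of_mem_erase (Finset.mem_toLeft.1 hf)), hv⟩
    · rintro ⟨f, hf, hv⟩
      have hf := Finset.mem_toLeft.1 hf
      by_cases hfe : f = e
      · obtain ⟨f', hf', hv', hne⟩ := hcon v (hfe ▸ hv)
        exact ⟨f', Finset.mem_toLeft.2 (Finset.mem_erase.2 ⟨by simpa using hne, hf'⟩), hv'⟩
      · exact ⟨f, Finset.mem_toLeft.2 (Finset.mem_erase.2 ⟨by simpa using hfe, hf⟩), hv⟩
  rw [IsMixedEdgeCover, h1, h2]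
  exact h.1

/-- If every vertex of the cycle is touched, its members are all edges, as arcs have untouched
heads; but each end of an edge on the cycle is shared with a neighbouring edge, so there is no
private end. Otherwise, at an untouched vertex of largest rank, both cycle members are arcs entering
it, against injectivity of heads. -/
theorem IsMinimalCover.not_hasCycle [Finite V] (h : G.IsMinimalCover F) : ¬ G.HasCycle F := by
  classical
  obtain ⟨rank, hB, hinj, -⟩ := h.exists_rank
  rintro ⟨n, v, x, hv, hx, hc⟩
  have hn : n ≠ 0 := by
    rintro rfl
    have hd : (G.ends (x 0)).IsDiag := by
      rw [(hc 0).2]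
      exact congrArg v (Subsingleton.elim (α := Fin 1) _ _)
    rcases hx0 : x 0 with e | a
    · rw [hx0] at hd
      exact G.edge_loopless e hd
    · rw [hx0] at hd
      exact G.arc_loopless a hd
  have hne : ∀ i : Fin (n + 1), i + 1 ≠ i := by
    intro i hi
    have : (1 : Fin (n + 1)) = 0 := by simpa using hi
    rw [Fin.one_eq_zero_iff] at this
    omega
  have hin : ∀ i, v i ∈ G.ends (x i) := fun i => by rw [(hc i).2]; exact Sym2.mem_mk_left _ _
  have hin' : ∀ i, v (i + 1) ∈ G.ends (x i) := fun i => by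
    rw [(hc i).2]; exact Sym2.mem_mk_right _ _
  have hends : ∀ i w, w ∈ G.ends (x i) → ∃ j, w = v j := by
    intro i w hw
    rw [(hc i).2, Sym2.mem_iff] at hw
    rcases hw with rfl | rfl
    exacts [⟨_, rfl⟩, ⟨_, rfl⟩]
  have hpred : ∀ i, v i ∈ G.ends (x (i - 1)) := fun i => by
    have := hin' (i - 1)
    rwa [sub_add_cancel] at this
  have hpne : ∀ i : Fin (n + 1), i - 1 ≠ i := fun i hi => hne (i - 1) (by rw [sub_add_cancel]; exact hi.symm)
  by_cases hall : ∀ i, v i ∈ G.touched (edgePart F)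
  · have hedge : ∀ i, ∃ e, x i = Sum.inl e := by
      intro i
      rcases hxi : x i with e | a
      · exact ⟨e, rfl⟩
      · obtain ⟨j, hj⟩ := hends i (G.head a) (by rw [hxi]; exact Sym2.mem_mk_right _ _)
        have := (hB a (Finset.mem_toRight.2 (by rw [← hxi]; exact (hc i).1))).1
        rw [hj] at this
        exact absurd (hall j) this
    choose e he using hedge
    obtain ⟨w, hw, hpriv⟩ := h.exists_private_end (e := e 0) (by rw [← he]; exact (hc 0).1)
    have hcontra : ∀ i, i ≠ 0 → w ∈ G.ends (x i) → False := by
      intro i hi hwi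
      rw [he] at hwi
      have := hpriv (e i) (by rw [← he]; exact (hc i).1) hwi
      exact hi (hx (by rw [he, he, this]))
    have hw' : w ∈ G.ends (x 0) := by rw [he]; exact hw
    rw [(hc 0).2, Sym2.mem_iff] at hw'
    rcases hw' with rfl | rfl
    · exact hcontra (0 - 1) (hpne 0) (hpred 0)
    · exact hcontra (0 + 1) (hne 0) (hin _)
  · push Not at hall
    obtain ⟨i, hi, hmax⟩ := Finset.exists_max_image
      (Finset.univ.filter fun i => v i ∉ G.touched (edgePart F)) (fun i => rank (v i))
      (by obtain ⟨i, hi⟩ := hall; exact ⟨i, by simpa using hi⟩)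
    have hi := (Finset.mem_filter.1 hi).2
    have harc : ∀ j, v i ∈ G.ends (x j) → ∃ a ∈ arcPart F, x j = Sum.inr a ∧ G.head a = v i := by
      intro j hj
      rcases hxj : x j with e | a
      · rw [hxj] at hj
        exact absurd ⟨e, Finset.mem_toLeft.2 (by rw [← hxj]; exact (hc j).1), hj⟩ hi
      · have ha : a ∈ arcPart F := Finset.mem_toRight.2 (by rw [← hxj]; exact (hc j).1)
        refine ⟨a, ha, rfl, ?_⟩
        rw [hxj] at hj
        rcases Sym2.mem_iff.1 hj with ht | hh
        · obtain ⟨k, hk⟩ := hends j (G.head a) (by rw [hxj]; exact Sym2.mem_mk_right _ _)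
          obtain ⟨h1, h2⟩ := hB a ha
          rw [hk] at h1 h2
          rw [← ht] at h2
          exact absurd (hmax k (Finset.mem_filter.2 ⟨Finset.mem_univ _, h1⟩)) h2.not_ge
        · exact hh.symm
    obtain ⟨a, ha, hxa, hah⟩ := harc i (hin i)
    obtain ⟨b, hb, hxb, hbh⟩ := harc (i - 1) (hpred i)
    have hab : b = a := hinj hb ha (hbh.trans hah.symm)
    exact hpne i (hx (by rw [hxa, hxb, hab]))

theorem IsMinimalCover.isMixedCoveringForest [Finite V] (h : G.IsMinimalCover F) :
    G.IsMixedCoveringForest F := by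
  refine ⟨h.not_hasCycle, fun v => ?_⟩
  obtain ⟨-, -, -, h3⟩ := h.exists_rank
  by_cases hv : v ∈ G.touched (edgePart F)
  · obtain ⟨e, he, hve⟩ := hv
    exact ⟨Sum.inl e, Finset.mem_toLeft.1 he, hve⟩
  · obtain ⟨a, ha, hav⟩ := h3 v hv
    exact ⟨Sum.inr a, Finset.mem_toRight.1 ha, hav.symm⟩

end Minimal

end MixedGraph

/-! ### Exchanging two disjoint covers for a balanced pair -/

namespace MixedGraph

variable {V E A : Type*} {G : MixedGraph V E A}

theorem touched_union [DecidableEq E] (M N : Finset E) :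
    G.touched (M ∪ N) = G.touched M ∪ G.touched N := by
  ext v
  simp only [touched, Finset.mem_union, Set.mem_union, Set.mem_ofPred_eq, or_and_right, exists_or]

theorem IsMixedEdgeCover.not_disjoint {F : Finset (E ⊕ A)} (h : G.IsMixedEdgeCover F)
    {B : Finset A} (hB : arcPart F ⊆ B) {X : Set V} (hX : X.Nonempty)
    (hX0 : enteringArcs G.tail G.head B X = ∅) : ¬ Disjoint X (G.touched (edgePart F)) := by
  intro hd
  obtain ⟨a, ha⟩ := h.mono hB X hX hd
  rw [hX0] at ha
  exact absurd ha (Finset.notMem_empty a)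

/-- The minimal nonempty vertex sets that no arc of `B` enters. -/
def sourceComponents (G : MixedGraph V E A) (B : Finset A) : Set (Set V) :=
  {X | Minimal (fun X : Set V => X.Nonempty ∧ enteringArcs G.tail G.head B X = ∅) X}

theorem minimal_of_mem_sourceComponents {B : Finset A} {X : Set V}
    (hX : X ∈ G.sourceComponents B) :
    Minimal (fun X : Set V => X.Nonempty ∧ enteringArcs G.tail G.head B X = ∅) X :=
  hX

/-- An arc entering an intersection enters one of the two sets, so a nonempty intersection is itself
unentered and minimality applies. -/
theorem pairwiseDisjoint_sourceComponents (B : Finset A) :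
    (G.sourceComponents B).PairwiseDisjoint id := by
  intro X hX Y hY hne
  replace hX := minimal_of_mem_sourceComponents hX
  replace hY := minimal_of_mem_sourceComponents hY
  by_contra hd
  obtain ⟨v, hvX, hvY⟩ := Set.not_disjoint_iff.1 hd
  have hXY : (X ∩ Y).Nonempty ∧ enteringArcs G.tail G.head B (X ∩ Y) = ∅ := by
    refine ⟨⟨v, hvX, hvY⟩, Finset.eq_empty_of_forall_notMem fun a ha => ?_⟩
    obtain ⟨haB, ht, hh⟩ := mem_enteringArcs.1 ha
    by_cases htX : G.tail a ∈ X
    · have : a ∈ enteringArcs G.tail G.head B Y :=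
        mem_enteringArcs.2 ⟨haB, fun htY => ht ⟨htX, htY⟩, hh.2⟩
      rw [hY.prop.2] at this
      exact Finset.notMem_empty a this
    · have : a ∈ enteringArcs G.tail G.head B X := mem_enteringArcs.2 ⟨haB, htX, hh.1⟩
      rw [hX.prop.2] at this
      exact Finset.notMem_empty a this
  exact hne (Set.Subset.antisymm
    ((hX.le_of_le hXY Set.inter_subset_left).trans Set.inter_subset_right)
    ((hY.le_of_le hXY Set.inter_subset_right).trans Set.inter_subset_left))

/-- Edge sets that touch the same vertices as two disjoint covers, and both touch all source
components, are the edge parts of two disjoint covers using the same arcs. -/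
theorem exists_disjoint_covers_of_edgeParts [Finite V] [DecidableEq E] [DecidableEq A]
    {F₁ F₂ : Finset (E ⊕ A)}
    (h₁ : G.IsMixedEdgeCover F₁) (h₂ : G.IsMixedEdgeCover F₂) (hd : Disjoint F₁ F₂)
    {M₁ M₂ : Finset E} (hM : M₁ ∪ M₂ = edgePart F₁ ∪ edgePart F₂)
    (hK : ∀ K ∈ G.sourceComponents (arcPart F₁ ∪ arcPart F₂),
      ¬ Disjoint K (G.touched M₁) ∧ ¬ Disjoint K (G.touched M₂)) :
    ∃ B₁ B₂ : Finset A, B₁ ⊆ arcPart F₁ ∪ arcPart F₂ ∧ B₂ ⊆ arcPart F₁ ∪ arcPart F₂ ∧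
      Disjoint B₁ B₂ ∧ G.IsMixedEdgeCover (M₁.disjSum B₁) ∧ G.IsMixedEdgeCover (M₂.disjSum B₂) := by
  set B := arcPart F₁ ∪ arcPart F₂ with hB
  have hcut : RootCutCondition G.tail G.head B (G.touched M₁) (G.touched M₂) := by
    intro X hX
    -- An unentered set contains a source component, hence has demand zero. An entered set needs a
    -- second arc only if it misses both touched sets; then it misses those of `F₁` and `F₂`, and
    -- each of these disjoint covers supplies an arc.
    rcases (enteringArcs G.tail G.head B X).eq_empty_or_nonempty with h0 | h0
    · obtain ⟨K, hKX, hKmin⟩ := Set.Finite.exists_le_minimal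
        (s := {X : Set V | X.Nonempty ∧ enteringArcs G.tail G.head B X = ∅}) (Set.toFinite _)
        (show X ∈ _ from ⟨hX, h0⟩)
      obtain ⟨hK₁, hK₂⟩ := hK K hKmin
      rw [rootDemand, if_neg fun hd => hK₁ (hd.mono_left hKX),
        if_neg fun hd => hK₂ (hd.mono_left hKX)]
      exact Nat.zero_le _
    · have hpos := Finset.card_pos.2 h0
      by_cases hdX : Disjoint X (G.touched M₁) ∧ Disjoint X (G.touched M₂)
      · have hdis : Disjoint X (G.touched (edgePart F₁) ∪ G.touched (edgePart F₂)) := by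
          rw [← touched_union, ← hM, touched_union]
          exact Set.disjoint_union_right.2 hdX
        obtain ⟨hd₁, hd₂⟩ := Set.disjoint_union_right.1 hdis
        obtain ⟨a, ha⟩ := h₁ X hX hd₁
        obtain ⟨b, hb⟩ := h₂ X hX hd₂
        obtain ⟨haF, ha⟩ := mem_enteringArcs.1 ha
        obtain ⟨hbF, hb⟩ := mem_enteringArcs.1 hb
        have hab : a ≠ b := by
          rintro rfl
          exact Finset.disjoint_left.1 hd (Finset.mem_toRight.1 haF) (Finset.mem_toRight.1 hbF)
        have : 1 < (enteringArcs G.tail G.head B X).card := Finset.one_lt_card.2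
          ⟨a, mem_enteringArcs.2 ⟨Finset.mem_union_left _ haF, ha⟩,
            b, mem_enteringArcs.2 ⟨Finset.mem_union_right _ hbF, hb⟩, hab⟩
        rw [rootDemand, if_pos hdX.1, if_pos hdX.2]
        exact this
      · rw [rootDemand]
        split_ifs <;> first | omega | exact absurd ⟨‹_›, ‹_›⟩ hdX
  obtain ⟨B₁, B₂, hB₁, hB₂, hBd, hs₁, hs₂⟩ := hcut.exists_disjoint_spansFrom
  refine ⟨B₁, B₂, hB₁, hB₂, hBd, ?_, ?_⟩
  · rw [IsMixedEdgeCover, arcPart, edgePart, Finset.toLeft_disjSum, Finset.toRight_disjSum]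
    exact hs₁
  · rw [IsMixedEdgeCover, arcPart, edgePart, Finset.toLeft_disjSum, Finset.toRight_disjSum]
    exact hs₂

theorem card_edgePart_add_card_arcPart (F : Finset (E ⊕ A)) :
    (edgePart F).card + (arcPart F).card = F.card :=
  Finset.card_toLeft_add_card_toRight

open Classical in
/-- The edges of `F₁ ∪ F₂` can be distributed to two sets that touch all source components in a
balanced way. -/
theorem exists_balanced_edgeParts [Fintype V] {F₁ F₂ : Finset (E ⊕ A)}
    (h₁ : G.IsMixedEdgeCover F₁) (h₂ : G.IsMixedEdgeCover F₂) (hd : Disjoint F₁ F₂) :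
    ∃ M₁ M₂ : Finset E, M₁ ∪ M₂ = edgePart F₁ ∪ edgePart F₂ ∧ Disjoint M₁ M₂ ∧
      (∀ K ∈ G.sourceComponents (arcPart F₁ ∪ arcPart F₂),
        ¬ Disjoint K (G.touched M₁) ∧ ¬ Disjoint K (G.touched M₂)) ∧
      |(M₁.card : ℤ) - M₂.card| ≤ 2 ∧
      |((G.touched M₁).ncard : ℤ) - (G.touched M₂).ncard| ≤ 2 ∧
      |((G.touched M₁).ncard : ℤ) - (G.touched M₂).ncard - (M₁.card - M₂.card)| ≤ 1 := by
  set M := edgePart F₁ ∪ edgePart F₂ with hM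
  let ends : M → Sym2 V := fun e => G.edgeEnds e
  have hd' : ∀ e, e ∈ edgePart F₂ → e ∉ edgePart F₁ := fun e he₂ he₁ =>
    Finset.disjoint_left.1 hd (Finset.mem_toLeft.1 he₁) (Finset.mem_toLeft.1 he₂)
  have hex : ∃ χ, ValidColoring ends (G.sourceComponents (arcPart F₁ ∪ arcPart F₂)) χ := by
    refine ⟨fun e => if (e : E) ∈ edgePart F₁ then 1 else -1, fun e => ?_, fun K hKm => ?_⟩
    · dsimp only
      split_ifs <;> simp
    have hK := minimal_of_mem_sourceComponents hKm
    constructor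
    · obtain ⟨v, hv, e, he, hve⟩ := Set.not_disjoint_iff.1
        (h₁.not_disjoint Finset.subset_union_left hK.prop.1 hK.prop.2)
      exact ⟨v, hv, ⟨e, Finset.mem_union_left _ he⟩, if_pos he, hve⟩
    · obtain ⟨v, hv, e, he, hve⟩ := Set.not_disjoint_iff.1
        (h₂.not_disjoint Finset.subset_union_right hK.prop.1 hK.prop.2)
      exact ⟨v, hv, ⟨e, Finset.mem_union_right _ he⟩, if_neg (hd' e he), hve⟩
  obtain ⟨χ, ⟨hχ, hK⟩, hb⟩ := exists_balanced_coloring ends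
    (pairwiseDisjoint_sourceComponents (arcPart F₁ ∪ arcPart F₂)) hex
  let N : ℤ → Finset E := fun s => (Finset.univ.filter fun e => χ e = s).map
    (Function.Embedding.subtype _)
  have hmem : ∀ s e, e ∈ N s ↔ ∃ he : e ∈ M, χ ⟨e, he⟩ = s := by
    intro s e
    simp [N]
  have htouch : ∀ s, G.touched (N s) = {v | SeesColor ends χ s v} := by
    intro s
    ext v
    constructor
    · rintro ⟨e, he, hv⟩
      obtain ⟨he, hs⟩ := (hmem s e).1 he
      exact ⟨⟨e, he⟩, hs, hv⟩
    · rintro ⟨⟨e, he⟩, hs, hv⟩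
      exact ⟨e, (hmem s e).2 ⟨he, hs⟩, hv⟩
  have hcardN : ((N 1).card : ℤ) - (N (-1)).card = ∑ e, χ e := by
    simp only [N, Finset.card_map, Finset.card_filter]
    push_cast
    rw [← Finset.sum_sub_distrib]
    refine Finset.sum_congr rfl fun e _ => ?_
    rcases hχ e with h | h <;> simp [h]
  have hcardT : ((G.touched (N 1)).ncard : ℤ) - (G.touched (N (-1))).ncard =
      ∑ v, ((if SeesColor ends χ 1 v then (1 : ℤ) else 0) -
        (if SeesColor ends χ (-1) v then 1 else 0)) := by
    have hc : ∀ s, ((G.touched (N s)).ncard : ℤ) = ∑ v, if SeesColor ends χ s v then 1 else 0 := by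
      intro s
      rw [htouch, Set.ncard_eq_toFinset_card', Set.toFinset_ofPred, Finset.card_filter]
      push_cast
      rfl
    rw [hc, hc, ← Finset.sum_sub_distrib]
  refine ⟨N 1, N (-1), ?_, ?_, fun K hKm => ?_, ?_⟩
  · ext e
    rw [Finset.mem_union, hmem, hmem]
    constructor
    · rintro (⟨he, -⟩ | ⟨he, -⟩) <;> exact he
    · intro he
      exact (hχ ⟨e, he⟩).imp (fun h => ⟨he, h⟩) fun h => ⟨he, h⟩
  · refine Finset.disjoint_left.2 fun e h1 h2 => ?_
    obtain ⟨he, h1⟩ := (hmem 1 e).1 h1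
    obtain ⟨_, hχ2⟩ := (hmem (-1) e).1 h2
    exact absurd (h1.symm.trans hχ2) (by norm_num)
  · rw [htouch, htouch]
    obtain ⟨⟨v, hv, hs⟩, w, hw, hs'⟩ := hK K hKm
    exact ⟨Set.not_disjoint_iff.2 ⟨v, hv, hs⟩, Set.not_disjoint_iff.2 ⟨w, hw, hs'⟩⟩
  · rw [hcardN, hcardT]
    exact hb

/-- Two disjoint covers of minimum total size can be exchanged for two balanced ones. -/
theorem exists_balanced_pair [Finite V] {F₁ F₂ : Finset (E ⊕ A)}
    (h₁ : G.IsMixedEdgeCover F₁) (h₂ : G.IsMixedEdgeCover F₂) (hd : Disjoint F₁ F₂)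
    (hmin : ∀ H₁ H₂, G.IsMixedEdgeCover H₁ → G.IsMixedEdgeCover H₂ → Disjoint H₁ H₂ →
      (∀ x, x ∈ H₁ ∨ x ∈ H₂ → x ∈ F₁ ∨ x ∈ F₂) → F₁.card + F₂.card ≤ H₁.card + H₂.card) :
    ∃ H₁ H₂, G.IsMixedEdgeCover H₁ ∧ G.IsMixedEdgeCover H₂ ∧ Disjoint H₁ H₂ ∧
      (∀ x, x ∈ H₁ ∨ x ∈ H₂ → x ∈ F₁ ∨ x ∈ F₂) ∧ H₁.card + H₂.card = F₁.card + F₂.card ∧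
      |(H₁.card : ℤ) - H₂.card| ≤ 1 ∧
      |((edgePart H₁).card : ℤ) - (edgePart H₂).card| ≤ 2 ∧
      |((arcPart H₁).card : ℤ) - (arcPart H₂).card| ≤ 2 := by
  classical
  have := Fintype.ofFinite V
  obtain ⟨M₁, M₂, hM, hMd, hK, hb₁, hb₂, hb₃⟩ := exists_balanced_edgeParts h₁ h₂ hd
  obtain ⟨B₁, B₂, hB₁, hB₂, hBd, hc₁, hc₂⟩ := exists_disjoint_covers_of_edgeParts h₁ h₂ hd hM hK
  have hHd : Disjoint (M₁.disjSum B₁) (M₂.disjSum B₂) := by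
    refine Finset.disjoint_left.2 ?_
    rintro (e | a) h h'
    · exact Finset.disjoint_left.1 hMd (Finset.inl_mem_disjSum.1 h) (Finset.inl_mem_disjSum.1 h')
    · exact Finset.disjoint_left.1 hBd (Finset.inr_mem_disjSum.1 h) (Finset.inr_mem_disjSum.1 h')
  have hHF : ∀ x, x ∈ M₁.disjSum B₁ ∨ x ∈ M₂.disjSum B₂ → x ∈ F₁ ∨ x ∈ F₂ := by
    rintro (e | a) h
    · rw [Finset.inl_mem_disjSum, Finset.inl_mem_disjSum, ← Finset.mem_union, hM,
        Finset.mem_union] at h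
      exact h.imp Finset.mem_toLeft.1 Finset.mem_toLeft.1
    · rw [Finset.inr_mem_disjSum, Finset.inr_mem_disjSum] at h
      have := Finset.mem_union.1 (h.elim (fun h => hB₁ h) fun h => hB₂ h)
      exact this.imp Finset.mem_toRight.1 Finset.mem_toRight.1
  have hle : (M₁.disjSum B₁).card + (M₂.disjSum B₂).card ≤ F₁.card + F₂.card := by
    rw [← Finset.card_union_of_disjoint hHd, ← Finset.card_union_of_disjoint hd]
    exact Finset.card_le_card fun x hx => Finset.mem_union.2 (hHF x (Finset.mem_union.1 hx))
  -- A removable member would contradict the minimum total size.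
  have hm₁ : G.IsMinimalCover (M₁.disjSum B₁) := by
    refine ⟨hc₁, fun x hx hcov => ?_⟩
    have := hmin _ _ hcov hc₂ (hHd.mono_left (Finset.erase_subset _ _))
      fun y hy => hHF y (hy.imp_left Finset.mem_of_mem_erase)
    have := Finset.card_erase_lt_of_mem hx
    omega
  have hm₂ : G.IsMinimalCover (M₂.disjSum B₂) := by
    refine ⟨hc₂, fun x hx hcov => ?_⟩
    have := hmin _ _ hc₁ hcov (hHd.mono_right (Finset.erase_subset _ _))
      fun y hy => hHF y (hy.imp_right Finset.mem_of_mem_erase)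
    have := Finset.card_erase_lt_of_mem hx
    omega
  have ha₁ := hm₁.card_arcPart
  have ha₂ := hm₂.card_arcPart
  have hs₁ := Set.ncard_add_ncard_compl (G.touched M₁)
  have hs₂ := Set.ncard_add_ncard_compl (G.touched M₂)
  refine ⟨_, _, hc₁, hc₂, hHd, hHF, hle.antisymm (hmin _ _ hc₁ hc₂ hHd hHF), ?_⟩
  -- The arc counts differ by minus the difference of the touched counts. The sizes therefore differ
  -- by the quantity that `hb₃` bounds by 1, up to sign.
  rw [← card_edgePart_add_card_arcPart (M₁.disjSum B₁),
    ← card_edgePart_add_card_arcPart (M₂.disjSum B₂), ha₁, ha₂]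
  simp only [edgePart, Finset.toLeft_disjSum]
  simp only [abs_le] at *
  push_cast
  omega

end MixedGraph

/-! ### Lexicographically minimal packings -/

theorem sum_update_update {κ α : Type*} [Fintype κ] [DecidableEq κ] (F : κ → α) (φ : α → ℕ)
    {i j : κ} (hij : i ≠ j) (a b : α) :
    ∑ l, φ (Function.update (Function.update F i a) j b l) + (φ (F i) + φ (F j)) =
      ∑ l, φ (F l) + (φ a + φ b) := by
  have hj : j ∈ Finset.univ.erase i := Finset.mem_erase.2 ⟨hij.symm, Finset.mem_univ _⟩
  have hrest : ∑ l ∈ (Finset.univ.erase i).erase j,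
      φ (Function.update (Function.update F i a) j b l) =
      ∑ l ∈ (Finset.univ.erase i).erase j, φ (F l) := by
    refine Finset.sum_congr rfl fun l hl => ?_
    simp only [Finset.mem_erase, Finset.mem_univ, and_true] at hl
    rw [Function.update_of_ne hl.1, Function.update_of_ne hl.2]
  rw [← Finset.add_sum_erase _ _ (Finset.mem_univ i), ← Finset.add_sum_erase _ _ hj,
    ← Finset.add_sum_erase _ (fun l => φ (F l)) (Finset.mem_univ i),
    ← Finset.add_sum_erase _ (fun l => φ (F l)) hj, hrest, Function.update_self,
    Function.update_of_ne hij, Function.update_self]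
  ring

namespace MixedGraph

variable {V E A : Type*} (G : MixedGraph V E A)

/-- A family of pairwise disjoint mixed edge covers. -/
def IsCoverPacking {κ : Type*} (F : κ → Finset (E ⊕ A)) : Prop :=
  (∀ i, G.IsMixedEdgeCover (F i)) ∧ ∀ i j, i ≠ j → Disjoint (F i) (F j)

variable {G}

theorem IsCoverPacking.update_pair {κ : Type*} [DecidableEq κ] {F : κ → Finset (E ⊕ A)}
    (hF : G.IsCoverPacking F) {i j : κ} {H₁ H₂ : Finset (E ⊕ A)} (h₁ : G.IsMixedEdgeCover H₁)
    (h₂ : G.IsMixedEdgeCover H₂) (hd : Disjoint H₁ H₂)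
    (hsub : ∀ x, x ∈ H₁ ∨ x ∈ H₂ → x ∈ F i ∨ x ∈ F j) :
    G.IsCoverPacking (Function.update (Function.update F i H₁) j H₂) := by
  have hother : ∀ l, l ≠ i → l ≠ j → Disjoint H₁ (F l) ∧ Disjoint H₂ (F l) := by
    intro l hli hlj
    have : ∀ x, x ∈ H₁ ∨ x ∈ H₂ → x ∉ F l := fun x hx hxl => by
      rcases hsub x hx with h | h
      · exact Finset.disjoint_left.1 (hF.2 l i hli) hxl h
      · exact Finset.disjoint_left.1 (hF.2 l j hlj) hxl h
    exact ⟨Finset.disjoint_left.2 fun x hx => this x (Or.inl hx),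
      Finset.disjoint_left.2 fun x hx => this x (Or.inr hx)⟩
  constructor
  · intro l
    simp only [Function.update_apply]
    split_ifs
    exacts [h₂, h₁, hF.1 l]
  · intro l m hlm
    simp only [Function.update_apply]
    split_ifs with a b c d e f g
    · exact absurd (a.trans b.symm) hlm
    · exact hd.symm
    · exact (hother m c b).2
    · exact hd
    · exact absurd (d.trans f.symm) hlm
    · exact (hother m f e).1
    · exact (hother l d a).2.symm
    · exact (hother l d a).1.symm
    · exact hF.2 l m hlm

theorem IsCoverPacking.erase {κ : Type*} [DecidableEq κ] [DecidableEq E] [DecidableEq A]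
    {F : κ → Finset (E ⊕ A)}
    (hF : G.IsCoverPacking F) (i : κ) {x : E ⊕ A} (h : G.IsMixedEdgeCover ((F i).erase x)) :
    G.IsCoverPacking (Function.update F i ((F i).erase x)) := by
  constructor
  · intro l
    rw [Function.update_apply]
    split_ifs
    exacts [h, hF.1 l]
  · intro l m hlm
    have hsub : ∀ l, Function.update F i ((F i).erase x) l ⊆ F l := by
      intro l
      rw [Function.update_apply]
      split_ifs with hl
      · rw [hl]
        exact Finset.erase_subset _ _
      · exact subset_rfl
    exact (hF.2 l m hlm).mono (hsub l) (hsub m)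

/-- The quantity minimized lexicographically by a balanced packing of covers. -/
def imbalance {κ : Type*} [Fintype κ] (F : κ → Finset (E ⊕ A)) : ℕ ×ₗ ℕ ×ₗ ℕ :=
  toLex (∑ l, (F l).card, toLex (∑ l, (F l).card ^ 2,
    ∑ l, ((edgePart (F l)).card ^ 2 + (arcPart (F l)).card ^ 2)))

theorem imbalance_le_iff {κ : Type*} [Fintype κ] {F F' : κ → Finset (E ⊕ A)} :
    imbalance F ≤ imbalance F' ↔ ∑ l, (F l).card < ∑ l, (F' l).card ∨
      ∑ l, (F l).card = ∑ l, (F' l).card ∧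
        (∑ l, (F l).card ^ 2 < ∑ l, (F' l).card ^ 2 ∨
          ∑ l, (F l).card ^ 2 = ∑ l, (F' l).card ^ 2 ∧
            ∑ l, ((edgePart (F l)).card ^ 2 + (arcPart (F l)).card ^ 2) ≤
              ∑ l, ((edgePart (F' l)).card ^ 2 + (arcPart (F' l)).card ^ 2)) := by
  rw [imbalance, imbalance, Prod.Lex.toLex_le_toLex, Prod.Lex.toLex_le_toLex]

/-- For a fixed sum, the sum of squares is governed by the squared difference. Equal sums force
differences of equal parity, so two differences of absolute value at most 1 agree up to sign. -/
theorem abs_sub_le_one_of_sq_add_sq_le {t₁ t₂ h₁ h₂ : ℤ} (hsum : h₁ + h₂ = t₁ + t₂)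
    (hd : |h₁ - h₂| ≤ 1) (hle : t₁ ^ 2 + t₂ ^ 2 ≤ h₁ ^ 2 + h₂ ^ 2) :
    |t₁ - t₂| ≤ 1 ∧ t₁ ^ 2 + t₂ ^ 2 = h₁ ^ 2 + h₂ ^ 2 := by
  have h1 : |h₁ - h₂| ^ 2 ≤ 1 := by nlinarith [abs_nonneg (h₁ - h₂)]
  rw [sq_abs] at h1
  have h2 : (h₁ + h₂) ^ 2 = (t₁ + t₂) ^ 2 := by rw [hsum]
  have h3 : |t₁ - t₂| ≤ 1 := by
    by_contra! hcon
    have h4 : 2 ^ 2 ≤ |t₁ - t₂| ^ 2 := by gcongr; omega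
    rw [sq_abs] at h4
    nlinarith
  refine ⟨h3, ?_⟩
  have h5 : t₁ - t₂ = h₁ - h₂ ∨ t₁ - t₂ = -(h₁ - h₂) := by
    rw [abs_le] at hd h3
    omega
  have h6 : (t₁ - t₂) ^ 2 = (h₁ - h₂) ^ 2 := sq_eq_sq_iff_eq_or_eq_neg.2 h5
  nlinarith

/-- With the sums fixed, the squared differences add up to at most 4 + 4 = 8, and a difference of 3
would already give 9. -/
theorem abs_sub_le_two_of_sq_le {e₁ e₂ a₁ a₂ e₁' e₂' a₁' a₂' : ℤ}
    (he : e₁ + e₂ = e₁' + e₂') (ha : a₁ + a₂ = a₁' + a₂')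
    (he' : |e₁' - e₂'| ≤ 2) (ha' : |a₁' - a₂'| ≤ 2)
    (hle : e₁ ^ 2 + a₁ ^ 2 + (e₂ ^ 2 + a₂ ^ 2) ≤ e₁' ^ 2 + a₁' ^ 2 + (e₂' ^ 2 + a₂' ^ 2)) :
    |e₁ - e₂| ≤ 2 ∧ |a₁ - a₂| ≤ 2 := by
  have h1 : |e₁' - e₂'| ^ 2 ≤ 2 ^ 2 := by gcongr
  have h2 : |a₁' - a₂'| ^ 2 ≤ 2 ^ 2 := by gcongr
  rw [sq_abs] at h1 h2
  have h3 : (e₁ + e₂) ^ 2 = (e₁' + e₂') ^ 2 := by rw [he]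
  have h4 : (a₁ + a₂) ^ 2 = (a₁' + a₂') ^ 2 := by rw [ha]
  have h5 : (e₁ - e₂) ^ 2 + (a₁ - a₂) ^ 2 ≤ 8 := by nlinarith
  constructor
  · by_contra! hcon
    have h6 : 3 ^ 2 ≤ |e₁ - e₂| ^ 2 := by gcongr; omega
    rw [sq_abs] at h6
    nlinarith [sq_nonneg (a₁ - a₂)]
  · by_contra! hcon
    have h6 : 3 ^ 2 ≤ |a₁ - a₂| ^ 2 := by gcongr; omega
    rw [sq_abs] at h6
    nlinarith [sq_nonneg (e₁ - e₂)]

/-- Containment gives an inequality for each part, and equal totals force equality in both. -/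
theorem card_union_parts {F₁ F₂ H₁ H₂ : Finset (E ⊕ A)} (hd : Disjoint F₁ F₂)
    (hHd : Disjoint H₁ H₂) (hsub : ∀ x, x ∈ H₁ ∨ x ∈ H₂ → x ∈ F₁ ∨ x ∈ F₂)
    (hcard : H₁.card + H₂.card = F₁.card + F₂.card) :
    (edgePart F₁).card + (edgePart F₂).card = (edgePart H₁).card + (edgePart H₂).card ∧
      (arcPart F₁).card + (arcPart F₂).card = (arcPart H₁).card + (arcPart H₂).card := by
  have key : (edgePart H₁).card + (edgePart H₂).card ≤
        (edgePart F₁).card + (edgePart F₂).card ∧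
      (arcPart H₁).card + (arcPart H₂).card ≤ (arcPart F₁).card + (arcPart F₂).card := by
    classical
    have hl : ∀ {P Q : Finset (E ⊕ A)}, Disjoint P Q → Disjoint (edgePart P) (edgePart Q) :=
      fun h => Finset.disjoint_left.2 fun e h1 h2 =>
        Finset.disjoint_left.1 h (Finset.mem_toLeft.1 h1) (Finset.mem_toLeft.1 h2)
    have hr : ∀ {P Q : Finset (E ⊕ A)}, Disjoint P Q → Disjoint (arcPart P) (arcPart Q) :=
      fun h => Finset.disjoint_left.2 fun e h1 h2 =>
        Finset.disjoint_left.1 h (Finset.mem_toRight.1 h1) (Finset.mem_toRight.1 h2)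
    rw [← Finset.card_union_of_disjoint (hl hd), ← Finset.card_union_of_disjoint (hl hHd),
      ← Finset.card_union_of_disjoint (hr hd), ← Finset.card_union_of_disjoint (hr hHd)]
    constructor
    · refine Finset.card_le_card fun e he => ?_
      simp only [edgePart, Finset.mem_union, Finset.mem_toLeft] at he ⊢
      exact hsub _ he
    · refine Finset.card_le_card fun e he => ?_
      simp only [arcPart, Finset.mem_union, Finset.mem_toRight] at he ⊢
      exact hsub _ he
  have := card_edgePart_add_card_arcPart F₁
  have := card_edgePart_add_card_arcPart F₂
  have := card_edgePart_add_card_arcPart H₁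
  have := card_edgePart_add_card_arcPart H₂
  omega

end MixedGraph

theorem mainTheorem8 {V E A : Type*} [Finite V] [Finite E] [Finite A]
    (G : MixedGraph V E A) (k : ℕ)
    (h : ∃ F : Fin k → Finset (E ⊕ A),
      (∀ i, G.IsMixedCoveringForest (F i)) ∧ ∀ i j, i ≠ j → Disjoint (F i) (F j)) :
    ∃ F : Fin k → Finset (E ⊕ A),
      (∀ i, G.IsMixedCoveringForest (F i)) ∧
      (∀ i j, i ≠ j → Disjoint (F i) (F j)) ∧
      ∀ i j,
        |((F i).card : ℤ) - ((F j).card : ℤ)| ≤ 1 ∧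
        |((edgePart (F i)).card : ℤ) - ((edgePart (F j)).card : ℤ)| ≤ 2 ∧
        |((arcPart (F i)).card : ℤ) - ((arcPart (F j)).card : ℤ)| ≤ 2 := by
  classical
  obtain ⟨F₀, hF₀, hd₀⟩ := h
  obtain ⟨F, hF, hmin⟩ := Set.exists_min_image
    {F : Fin k → Finset (E ⊕ A) | G.IsCoverPacking F} MixedGraph.imbalance (Set.toFinite _)
    ⟨F₀, fun i => (hF₀ i).isMixedEdgeCover, hd₀⟩
  replace hF : G.IsCoverPacking F := hF
  replace hmin : ∀ F', G.IsCoverPacking F' → MixedGraph.imbalance F ≤ MixedGraph.imbalance F' :=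
    hmin
  have hforest : ∀ i, G.IsMinimalCover (F i) := by
    refine fun i => ⟨hF.1 i, fun x hx hc => ?_⟩
    have hlt : ∑ l, (Function.update F i ((F i).erase x) l).card < ∑ l, (F l).card := by
      refine Finset.sum_lt_sum (fun l _ => ?_) ⟨i, Finset.mem_univ _, ?_⟩
      · by_cases hl : l = i
        · subst hl
          rw [Function.update_self]
          exact Finset.card_le_card (Finset.erase_subset _ _)
        · rw [Function.update_of_ne hl]
      · rw [Function.update_self]
        exact Finset.card_erase_lt_of_mem hx
    have := MixedGraph.imbalance_le_iff.1 (hmin _ (hF.erase i hc))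
    omega
  refine ⟨F, fun i => (hforest i).isMixedCoveringForest, hF.2, fun i j => ?_⟩
  by_cases hij : i = j
  · subst hij
    simp
  obtain ⟨H₁, H₂, hc₁, hc₂, hHd, hsub, hcard, ht, he, ha⟩ := MixedGraph.exists_balanced_pair
    (hF.1 i) (hF.1 j) (hF.2 i j hij) fun H₁ H₂ hc₁ hc₂ hHd hsub => by
      have h1 := MixedGraph.imbalance_le_iff.1 (hmin _ (hF.update_pair hc₁ hc₂ hHd hsub))
      have h2 := sum_update_update F Finset.card hij H₁ H₂
      omega
  have h1 := MixedGraph.imbalance_le_iff.1 (hmin _ (hF.update_pair hc₁ hc₂ hHd hsub))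
  have h2 := sum_update_update F Finset.card hij H₁ H₂
  have h3 := sum_update_update F (fun P => P.card ^ 2) hij H₁ H₂
  have h4 := sum_update_update F
    (fun P => (edgePart P).card ^ 2 + (arcPart P).card ^ 2) hij H₁ H₂
  -- The exchange preserves the total size, so the second lexicographic coordinate decides.
  have h5 : (F i).card ^ 2 + (F j).card ^ 2 ≤ H₁.card ^ 2 + H₂.card ^ 2 := by omega
  obtain ⟨h6, h7⟩ := MixedGraph.abs_sub_le_one_of_sq_add_sq_le (t₁ := (F i).card)
    (t₂ := (F j).card) (h₁ := H₁.card) (h₂ := H₂.card) (by exact_mod_cast hcard) ht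
    (by exact_mod_cast h5)
  have h8 : (F i).card ^ 2 + (F j).card ^ 2 = H₁.card ^ 2 + H₂.card ^ 2 := by exact_mod_cast h7
  -- By `h8` the second coordinate ties as well, which leaves the third.
  have h9 : (edgePart (F i)).card ^ 2 + (arcPart (F i)).card ^ 2 +
      ((edgePart (F j)).card ^ 2 + (arcPart (F j)).card ^ 2) ≤
      (edgePart H₁).card ^ 2 + (arcPart H₁).card ^ 2 +
        ((edgePart H₂).card ^ 2 + (arcPart H₂).card ^ 2) := by omega
  obtain ⟨hE, hA⟩ := MixedGraph.card_union_parts (hF.2 i j hij) hHd hsub hcard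
  exact ⟨h6, MixedGraph.abs_sub_le_two_of_sq_le (by exact_mod_cast hE) (by exact_mod_cast hA)
    he ha (by exact_mod_cast h9)⟩
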